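/- For $n\ge 2$ let $A085680(n)$ be the maximum size of a binary code $C\subseteq\mathbb F_2^n$ of constant weight $2$ (every codeword has exactly two $1$'s) that can correct a single adjacent transposition; that is, $B(u)\cap B(v)=\emptyset$ for all distinct $u,v\in C$, where $B(u)$ consists of $u$ and all vectors obtained from $u$ by transposing two adjacent bits. Then, as an identity of formal power series over $\mathbb Q$, $$\sum_{n\ge 0} A085680(n+2)\,x^n=\frac{1-x+x^2-x^{10}+x^{11}}{(1-x)^2(1-x^5)}.$$ -/

import Mathlib

/-- The received words that can result from sending `u ∈ 𝔽₂ⁿ` when at most one pair of adjacent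
bits is transposed: `u` itself, and every word got from `u` by exchanging the bits at two
consecutive positions. -/
def transpositionBall {n : ℕ} (u : Fin n → ZMod 2) : Set (Fin n → ZMod 2) :=
  {v | v = u ∨ ∃ i j : Fin n, (j : ℕ) = (i : ℕ) + 1 ∧ v = u ∘ Equiv.swap i j}

/-- `C ⊆ 𝔽₂ⁿ` is a binary code of constant weight `w` that can correct a single adjacent
transposition: each codeword has exactly `w` ones, and the balls around distinct codewords are
disjoint. -/
def IsTranspositionCode {n : ℕ} (w : ℕ) (C : Finset (Fin n → ZMod 2)) : Prop :=
  (∀ u ∈ C, hammingNorm u = w) ∧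
    ∀ u ∈ C, ∀ v ∈ C, u ≠ v → Disjoint (transpositionBall u) (transpositionBall v)

/-- The largest size of a binary code of length `n` and constant weight `w` that can correct a
single adjacent transposition. -/
noncomputable def maxTranspositionCode (n w : ℕ) : ℕ :=
  sSup {k | ∃ C : Finset (Fin n → ZMod 2), IsTranspositionCode w C ∧ C.card = k}

/-- The supremum in `maxTranspositionCode` is a maximum. -/
theorem maxTranspositionCode_isGreatest (n w : ℕ) :
    IsGreatest {k | ∃ C : Finset (Fin n → ZMod 2), IsTranspositionCode w C ∧ C.card = k}
      (maxTranspositionCode n w) := by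
  have hb : BddAbove
      {k | ∃ C : Finset (Fin n → ZMod 2), IsTranspositionCode w C ∧ C.card = k} := by
    refine ⟨Fintype.card (Fin n → ZMod 2), ?_⟩
    rintro k ⟨C, -, rfl⟩
    exact Finset.card_le_univ C
  refine ⟨Nat.sSup_mem ⟨0, ∅, ?_, rfl⟩ hb, fun k hk => le_csSup hb hk⟩
  simp [IsTranspositionCode]

/-- The sequence A085680 of the OEIS: the case of constant weight two. -/
noncomputable def A085680 (n : ℕ) : ℕ := maxTranspositionCode n 2

/-! A word with ones at positions `i < j` is the cell `(i, j)` of a triangle, and an adjacent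
transposition moves this cell to a neighbour inside the triangle. Two balls are disjoint exactly
when the cells are at lattice distance at least 3 (`disjoint_transpositionBall_iff`), so the code
size is the largest number of disjoint crosses with centres in the triangle `T` of side `N`, where
crosses may stick out of `T`.

Upper bound. Counting cells gives `5|S| + gaps ≤ |T| + outside`, where `gaps` counts the uncovered
cells of `T` and `outside` the parts of crosses beyond its edges (`five_mul_card_le`). Crosses that
overhang an edge force gaps near it: `outside - gaps ≤ 11` for `N ≥ 16` (`sum_boundary_le`). This is
proved with potentials, that is, polynomials in the indicators of a few cells. Moving one step along
an edge, gain minus gaps plus the change of potential is at most 0, so the edges telescope and the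
constant is collected at the three corners (4 each) and at one junction on the diagonal edge (-1).
Each local inequality concerns a bounded window and is checked by a verified dynamic program over
all packings (`SweepOp.gainSum_le`). The same program settles the sides below 16 directly.

Lower bound. A class `x + 2y ≡ r (mod 5)` of the perfect Lee code has the right density, and
exchanging a few cells near the acute corners reaches the bound (`exists_packing_of_exchange`,
`exists_packing`).

Hence the maximum is `packingNumber`, which grows by a linear amount when its argument grows by 5
(`packingNumber_add_five`); this gives the rational generating function. -/

/-! ### A verified transfer-matrix bound for packings of crosses -/

/-- The lattice distance between two cells is at most two. -/
def closeCells (p q : ℤ × ℤ) : Bool :=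
  decide ((p.1 - q.1).natAbs + (p.2 - q.2).natAbs ≤ 2)

/-- The cells chosen by `χ` are centres of pairwise disjoint crosses. -/
def CrossPacking (χ : ℤ × ℤ → Bool) : Prop :=
  ∀ p q, χ p = true → χ q = true → closeCells p q = true → p = q

/-- The cross centred at a cell. -/
def cross (c : ℤ × ℤ) : List (ℤ × ℤ) :=
  [c, (c.1 - 1, c.2), (c.1 + 1, c.2), (c.1, c.2 - 1), (c.1, c.2 + 1)]

/-- The cell `c` belongs to no cross of the packing `χ`. -/
def uncovered (χ : ℤ × ℤ → Bool) (c : ℤ × ℤ) : Bool := (cross c).all fun q => !χ q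

/-! ### Decision trees as tables of states with upper bounds. -/

/-- A finite set of weighted `0`-`1` words, stored as a decision tree. The value `top` stands for
an absent bound. -/
inductive WordTree
  | nil
  | top
  | leaf (v : ℤ)
  | node (a b : WordTree)

namespace WordTree

/-- The tree contains the word `bs` with a weight of at least `v`. -/
def Dominates : WordTree → List Bool → ℤ → Prop
  | top, _, _ => True
  | leaf w, [], v => v ≤ w
  | node a b, x :: xs, v => if x = true then b.Dominates xs v else a.Dominates xs v
  | _, _, _ => False

/-- Union of two trees, keeping the larger weight of a common word. -/
def merge : WordTree → WordTree → WordTree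
  | nil, t => t
  | leaf v, nil => leaf v
  | leaf v, leaf w => leaf (max v w)
  | node a b, nil => node a b
  | node a b, node c d => node (a.merge c) (b.merge d)
  | _, _ => top

/-- Append a letter, which must be `0` if one of the flagged letters is `1` or `blocked` is set. -/
def append : WordTree → List Bool → Bool → WordTree
  | nil, _, _ => nil
  | leaf v, [], blocked => node (leaf v) (bif blocked then nil else leaf v)
  | node a b, f :: fs, blocked => node (a.append fs blocked) (b.append fs (blocked || f))
  | _, _, _ => top

/-- Add `w` to the weight of the words whose flagged letters are all `1`. -/
def addIfAll (w : ℤ) : WordTree → List Bool → WordTree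
  | nil, _ => nil
  | leaf v, [] => leaf (v + w)
  | node a b, true :: fs => node a (b.addIfAll w fs)
  | node a b, false :: fs => node (a.addIfAll w fs) (b.addIfAll w fs)
  | _, _ => top

/-- Add `w` to the weight of the words whose flagged letters are all `0`. -/
def addIfNone (w : ℤ) : WordTree → List Bool → WordTree
  | nil, _ => nil
  | leaf v, [] => leaf (v + w)
  | node a b, true :: fs => node (a.addIfNone w fs) b
  | node a b, false :: fs => node (a.addIfNone w fs) (b.addIfNone w fs)
  | _, _ => top

/-- Erase the letters that are not flagged. -/
def restrict : WordTree → List Bool → WordTree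
  | nil, _ => nil
  | leaf v, [] => leaf v
  | node a b, true :: fs => node (a.restrict fs) (b.restrict fs)
  | node a b, false :: fs => (a.restrict fs).merge (b.restrict fs)
  | _, _ => top

/-- All weights are at most `K`. -/
def boundedBy (K : ℤ) : WordTree → Bool
  | nil => true
  | top => false
  | leaf v => decide (v ≤ K)
  | node a b => a.boundedBy K && b.boundedBy K

/-- Trees of incompatible shapes merge to `top`, which dominates everything, so no well-formedness
condition is needed. -/
theorem dominates_merge_left {t : WordTree} : ∀ {s : WordTree} {bs : List Bool} {v : ℤ},
    t.Dominates bs v → (t.merge s).Dominates bs v := by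
  induction t with
  | nil => intro s bs v h; simp [Dominates] at h
  | top => intro s bs v h; cases s <;> simp [merge, Dominates]
  | leaf w =>
    intro s bs v h
    cases bs <;> cases s <;> simp_all [merge, Dominates]
  | node a b iha ihb =>
    intro s bs v h
    cases bs with
    | nil => simp [Dominates] at h
    | cons x xs =>
      cases s with
      | node c d =>
        cases x <;> simp only [merge, Dominates] at h ⊢ <;> simp_all
      | _ => simp_all [merge, Dominates]

theorem dominates_merge_right {t : WordTree} : ∀ {s : WordTree} {bs : List Bool} {v : ℤ},
    s.Dominates bs v → (t.merge s).Dominates bs v := by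
  induction t with
  | nil => intro s bs v h; simpa [merge] using h
  | top => intro s bs v h; cases s <;> simp [merge, Dominates]
  | leaf w =>
    intro s bs v h
    cases bs <;> cases s <;> simp_all [merge, Dominates]
  | node a b iha ihb =>
    intro s bs v h
    cases s with
    | node c d =>
      cases bs with
      | nil => simp [Dominates] at h
      | cons x xs => cases x <;> simp only [merge, Dominates] at h ⊢ <;> simp_all
    | _ => simp_all [merge, Dominates]

theorem dominates_append {t : WordTree} (y : Bool) : ∀ {bs fs : List Bool} {blk : Bool} {v : ℤ},
    t.Dominates bs v → bs.length = fs.length →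
    (y = true → blk = false ∧ ∀ i : ℕ, (bs.zip fs)[i]? ≠ some (true, true)) →
    (t.append fs blk).Dominates (bs ++ [y]) v := by
  induction t with
  | nil => intro bs fs blk v h; simp [Dominates] at h
  | top => intro bs fs blk v h _ _; simp [append, Dominates]
  | leaf w =>
    intro bs fs blk v h hl hy
    cases bs with
    | cons x xs => simp [Dominates] at h
    | nil =>
      cases fs with
      | cons x xs => simp at hl
      | nil => cases y <;> simp_all [append, Dominates]
  | node a b iha ihb =>
    intro bs fs blk v h hl hy
    cases bs with
    | nil => simp [Dominates] at h
    | cons x xs =>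
      cases fs with
      | nil => simp at hl
      | cons f fs =>
        have hl' : xs.length = fs.length := by simpa using hl
        have hz : y = true → ∀ i : ℕ, (xs.zip fs)[i]? ≠ some (true, true) := fun h1 i => by
          simpa using (hy h1).2 (i + 1)
        cases x with
        | false =>
          simp only [append, Dominates, List.cons_append] at h ⊢
          exact iha (by simpa using h) hl' fun h1 => ⟨(hy h1).1, hz h1⟩
        | true =>
          simp only [append, Dominates, List.cons_append] at h ⊢
          refine ihb (by simpa using h) hl' fun h1 => ⟨?_, hz h1⟩
          have h0 := (hy h1).2 0
          have := (hy h1).1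
          cases f <;> simp_all

theorem dominates_addIfAll {t : WordTree} {w : ℤ} : ∀ {bs fs : List Bool} {v : ℤ},
    t.Dominates bs v → bs.length = fs.length →
    (t.addIfAll w fs).Dominates bs
      (v + if (bs.zip fs).all (fun p => p.1 || !p.2) then w else 0) := by
  induction t with
  | nil => intro bs fs v h; simp [Dominates] at h
  | top => intro bs fs v h _; simp [addIfAll, Dominates]
  | leaf u =>
    intro bs fs v h hl
    cases bs <;> cases fs <;> simp_all [addIfAll, Dominates]
  | node a b iha ihb =>
    intro bs fs v h hl
    cases bs with
    | nil => simp [Dominates] at h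
    | cons x xs =>
      cases fs with
      | nil => simp at hl
      | cons f fs =>
        have hl' : xs.length = fs.length := by simpa using hl
        cases x <;> cases f <;> simp only [addIfAll, Dominates, if_true] at h ⊢
        · simpa using iha (by simpa using h) hl'
        · simpa using h
        · simpa using ihb h hl'
        · simpa using ihb h hl'

theorem dominates_addIfNone {t : WordTree} {w : ℤ} : ∀ {bs fs : List Bool} {v : ℤ},
    t.Dominates bs v → bs.length = fs.length →
    (t.addIfNone w fs).Dominates bs
      (v + if (bs.zip fs).all (fun p => !p.1 || !p.2) then w else 0) := by
  induction t with
  | nil => intro bs fs v h; simp [Dominates] at h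
  | top => intro bs fs v h _; simp [addIfNone, Dominates]
  | leaf u =>
    intro bs fs v h hl
    cases bs <;> cases fs <;> simp_all [addIfNone, Dominates]
  | node a b iha ihb =>
    intro bs fs v h hl
    cases bs with
    | nil => simp [Dominates] at h
    | cons x xs =>
      cases fs with
      | nil => simp at hl
      | cons f fs =>
        have hl' : xs.length = fs.length := by simpa using hl
        cases x <;> cases f <;> simp only [addIfNone, Dominates, if_true] at h ⊢
        · simpa using iha (by simpa using h) hl'
        · simpa using iha (by simpa using h) hl'
        · simpa using ihb h hl'
        · simpa using h

/-- Words that differ only in an erased letter become equal; merging the two subtrees keeps the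
larger bound, so nothing dominated is lost. -/
theorem dominates_restrict {α : Type*} (χ keep : α → Bool) {t : WordTree} :
    ∀ {l : List α} {v : ℤ}, t.Dominates (l.map χ) v →
      (t.restrict (l.map keep)).Dominates ((l.filter keep).map χ) v := by
  induction t with
  | nil => intro l v h; simp [Dominates] at h
  | top => intro l v h; simp [restrict, Dominates]
  | leaf u => intro l v h; cases l <;> simp_all [restrict, Dominates]
  | node a b iha ihb =>
    intro l v h
    cases l with
    | nil => simp [Dominates] at h
    | cons x xs =>
      simp only [List.map_cons, Dominates] at h
      cases hk : keep x
      · simp only [List.map_cons, hk, restrict, List.filter_cons]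
        split_ifs at h
        · exact dominates_merge_right (by simpa using ihb h)
        · exact dominates_merge_left (by simpa using iha h)
      · simp only [List.map_cons, hk, restrict, List.filter_cons, if_true, Dominates]
        split_ifs at h ⊢
        · exact ihb h
        · exact iha h

theorem Dominates.le_of_boundedBy {t : WordTree} {K : ℤ} : ∀ {bs : List Bool} {v : ℤ},
    t.Dominates bs v → t.boundedBy K = true → v ≤ K := by
  induction t with
  | nil => intro bs v h; simp [Dominates] at h
  | top => intro bs v _ h; simp [boundedBy] at h
  | leaf u =>
    intro bs v h hb
    cases bs <;> simp_all [boundedBy, Dominates]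
    omega
  | node a b iha ihb =>
    intro bs v h hb
    simp only [boundedBy, Bool.and_eq_true] at hb
    cases bs with
    | nil => simp [Dominates] at h
    | cons x xs =>
      simp only [Dominates] at h
      split_ifs at h
      · exact ihb h hb.2
      · exact iha h hb.1

end WordTree

/-! ### Sweeps: a dynamic program over all packings. -/

/-- A step in the evaluation of a weighted sum over all packings: take up a new cell, add a weight
if the listed cells are all chosen, add a weight if a cell is uncovered, or forget the state of all
cells but those specified. -/
inductive SweepOp
  | take (c : ℤ × ℤ)
  | term (cs : List (ℤ × ℤ)) (w : ℤ)
  | gap (c : ℤ × ℤ) (w : ℤ)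
  | keep (f : ℤ × ℤ → Bool)

namespace SweepOp

/-- The contribution of a step to the weighted sum for the packing `χ`. -/
def score (χ : ℤ × ℤ → Bool) : SweepOp → ℤ
  | term cs w => if cs.all χ then w else 0
  | gap c w => if uncovered χ c then w else 0
  | _ => 0

/-- Perform one step on a list of active cells and the tree of their possible states; the cells
outside `dom` are known not to be chosen. -/
def exec (dom : ℤ × ℤ → Bool) (s : List (ℤ × ℤ) × WordTree) : SweepOp → List (ℤ × ℤ) × WordTree
  | take c => (s.1 ++ [c], s.2.append (s.1.map fun q => closeCells c q && !decide (c = q)) false)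
  | term cs w =>
    (s.1, bif cs.all (fun q => decide (q ∈ s.1))
      then s.2.addIfAll w (s.1.map fun q => decide (q ∈ cs)) else .top)
  | gap c w =>
    (s.1, bif (cross c).all (fun q => decide (q ∈ s.1) || !dom q)
      then s.2.addIfNone w (s.1.map fun q => decide (q ∈ cross c)) else .top)
  | keep f => (s.1.filter f, s.2.restrict (s.1.map f))

/-- The invariant of the dynamic program: the trace of every packing on the active cells occurs in
the tree with at least the weight scored so far. Forgetting a cell too early is harmless for
soundness: a later `take` merely excludes fewer words, and a `term` or `gap` that needs the cell
yields `top`, unless for `gap` the cell lies outside `dom`. -/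
theorem dominates_exec {dom χ : ℤ × ℤ → Bool} (hχ : CrossPacking χ)
    (hdom : ∀ c, χ c = true → dom c = true) (s : List (ℤ × ℤ) × WordTree) (v : ℤ)
    (h : s.2.Dominates (s.1.map χ) v) (o : SweepOp) :
    (exec dom s o).2.Dominates ((exec dom s o).1.map χ) (v + o.score χ) := by
  cases o with
  | take c =>
    simp only [exec, score, add_zero, List.map_append, List.map_cons, List.map_nil]
    refine WordTree.dominates_append _ h (by simp) fun hc => ⟨rfl, fun i hi => ?_⟩
    rw [List.zip_map', List.getElem?_map] at hi
    obtain ⟨q, -, hq⟩ := Option.map_eq_some_iff.mp hi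
    simp only [Prod.mk.injEq, Bool.and_eq_true, Bool.not_eq_true', decide_eq_false_iff_not] at hq
    exact hq.2.2 (hχ _ _ hc hq.1 hq.2.1)
  | term cs w =>
    simp only [exec, score]
    cases hc : cs.all (fun q => decide (q ∈ s.1)) with
    | false => simp [WordTree.Dominates]
    | true =>
      have := WordTree.dominates_addIfAll (w := w) (fs := s.1.map fun q => decide (q ∈ cs)) h
        (by simp)
      rw [cond_true]
      convert this using 3
      rw [List.zip_map', List.all_map]
      simp only [List.all_eq_true, decide_eq_true_eq, Function.comp, Bool.or_eq_true,
        Bool.not_eq_true', decide_eq_false_iff_not] at hc ⊢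
      exact ⟨fun h1 q _ => (em (q ∈ cs)).imp (h1 q) id,
        fun h1 q hq => (h1 q (hc q hq)).resolve_right fun h2 => h2 hq⟩
  | gap c w =>
    simp only [exec, score]
    cases hc : (cross c).all (fun q => decide (q ∈ s.1) || !dom q) with
    | false => simp [WordTree.Dominates]
    | true =>
      have := WordTree.dominates_addIfNone (w := w)
        (fs := s.1.map fun q => decide (q ∈ cross c)) h (by simp)
      rw [cond_true]
      convert this using 3
      rw [List.zip_map', List.all_map, uncovered]
      simp only [List.all_eq_true, decide_eq_true_eq, Function.comp, Bool.or_eq_true,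
        Bool.not_eq_true', decide_eq_false_iff_not] at hc ⊢
      refine ⟨fun h1 q _ => (em (q ∈ cross c)).imp (h1 q) id, fun h1 q hq => ?_⟩
      rcases hc q hq with h2 | h2
      · exact (h1 q h2).resolve_right fun h3 => h3 hq
      · by_contra h3
        simp [hdom q (by simpa using h3)] at h2
  | keep f =>
    simpa [exec, score] using WordTree.dominates_restrict χ f h

/-- Perform a list of steps. -/
def run (dom : ℤ × ℤ → Bool) (ops : List SweepOp) : List (ℤ × ℤ) × WordTree :=
  ops.foldl (exec dom) ([], .leaf 0)

/-- The weighted sum that a list of steps evaluates. -/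
def total (χ : ℤ × ℤ → Bool) (ops : List SweepOp) : ℤ := (ops.map (score χ)).sum

/-- The run does not depend on `χ`, so a single evaluation bounds the sum for all packings at once.
-/
theorem total_le {dom χ : ℤ × ℤ → Bool} (hχ : CrossPacking χ)
    (hdom : ∀ c, χ c = true → dom c = true) (ops : List SweepOp) {K : ℤ}
    (hK : (run dom ops).2.boundedBy K = true) : total χ ops ≤ K := by
  suffices H : ∀ (ops : List SweepOp) (s : List (ℤ × ℤ) × WordTree) (v : ℤ),
      s.2.Dominates (s.1.map χ) v →
      (ops.foldl (exec dom) s).2.Dominates ((ops.foldl (exec dom) s).1.map χ) (v + total χ ops) by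
    have := (H ops ([], .leaf 0) 0 (by simp [WordTree.Dominates])).le_of_boundedBy hK
    simpa using this
  intro ops
  induction ops with
  | nil => intro s v h; simpa [total] using h
  | cons o ops ih =>
    intro s v h
    have := ih _ _ (dominates_exec hχ hdom s v h o)
    simpa [total, add_assoc] using this

end SweepOp

namespace SweepOp

/-- Sweep over the cells `centres` in the order of their keys. The weights `gains` are collected
with the cell they belong to, the uncovered cells among `gaps` cost one each, and the weights
`bdry` are added in the end. -/
def sweep (key late : ℤ × ℤ → ℤ) (active : ℤ → ℤ × ℤ → Bool) (L : List ℤ)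
    (centres gaps : List (ℤ × ℤ)) (gains : List ((ℤ × ℤ) × ℤ))
    (bdry : List (List (ℤ × ℤ) × ℤ)) : List SweepOp :=
  (L.flatMap fun s =>
    (centres.filter fun c => decide (key c = s)).map take ++
    (gains.filter fun g => decide (key g.1 = s)).map (fun g => term [g.1] g.2) ++
    (gaps.filter fun c => decide (late c = s)).map (fun c => gap c (-1)) ++
    [keep (active s)]) ++
  bdry.map fun b => term b.1 b.2

/-- The number of uncovered cells in a list. -/
def gapCount (χ : ℤ × ℤ → Bool) (gaps : List (ℤ × ℤ)) : ℤ :=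
  (gaps.map fun c => if uncovered χ c then 1 else 0).sum

/-- The total weight of the chosen cells. -/
def gainSum (χ : ℤ × ℤ → Bool) (gains : List ((ℤ × ℤ) × ℤ)) : ℤ :=
  (gains.map fun g => if χ g.1 then g.2 else 0).sum

/-- The value of a polynomial in the indicators of cells. -/
def polyValue (χ : ℤ × ℤ → Bool) (bdry : List (List (ℤ × ℤ) × ℤ)) : ℤ :=
  (bdry.map fun b => if b.1.all χ then b.2 else 0).sum

theorem sum_map_filter_key {α : Type*} (key : α → ℤ) (f : α → ℤ) {L : List ℤ} (hL : L.Nodup) :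
    ∀ {A : List α}, (∀ a ∈ A, key a ∈ L) →
      (L.map fun s => ((A.filter fun a => decide (key a = s)).map f).sum).sum = (A.map f).sum := by
  intro A
  induction A with
  | nil => intro _; simp
  | cons a A ih =>
    intro h
    have h1 : ∀ s, (((a :: A).filter fun a => decide (key a = s)).map f).sum =
        (if s = key a then f a else 0) + ((A.filter fun a => decide (key a = s)).map f).sum := by
      intro s
      by_cases hs : key a = s
      · simp [hs]
      · simp [hs, Ne.symm hs]
    simp only [h1, List.sum_map_add, ih fun b hb => h b (List.mem_cons_of_mem _ hb), List.map_cons,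
      List.sum_cons, add_left_inj]
    rw [List.sum_map_ite_eq, List.count_eq_one_of_mem hL (h a List.mem_cons_self)]
    simp

theorem total_append (χ : ℤ × ℤ → Bool) (A B : List SweepOp) :
    total χ (A ++ B) = total χ A + total χ B := by
  simp [total]

theorem total_flatMap {α : Type*} (χ : ℤ × ℤ → Bool) (L : List α) (F : α → List SweepOp) :
    total χ (L.flatMap F) = (L.map fun s => total χ (F s)).sum := by
  induction L with
  | nil => simp [total]
  | cons a L ih => simp [total_append, ih]

/-- The keys only rearrange the sum: as `L` has no repetition and contains every key in use, each
gain and each gap is met exactly once. -/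
theorem total_sweep (χ : ℤ × ℤ → Bool) {key late : ℤ × ℤ → ℤ} {active : ℤ → ℤ × ℤ → Bool}
    {L : List ℤ} {centres gaps : List (ℤ × ℤ)} {gains : List ((ℤ × ℤ) × ℤ)}
    {bdry : List (List (ℤ × ℤ) × ℤ)} (hL : L.Nodup) (hgains : ∀ g ∈ gains, key g.1 ∈ L)
    (hgaps : ∀ c ∈ gaps, late c ∈ L) :
    total χ (sweep key late active L centres gaps gains bdry) =
      gainSum χ gains - gapCount χ gaps + polyValue χ bdry := by
  have h1 := sum_map_filter_key (fun g : (ℤ × ℤ) × ℤ => key g.1)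
    (fun g => if χ g.1 then g.2 else 0) hL hgains
  have h2 := sum_map_filter_key late (fun c => if uncovered χ c then (-1 : ℤ) else 0) hL hgaps
  have h3 : gapCount χ gaps = -(gaps.map fun c => if uncovered χ c then (-1 : ℤ) else 0).sum := by
    rw [gapCount, ← neg_eq_iff_eq_neg, List.sum_neg, List.map_map]
    congr 2 with c
    by_cases hc : uncovered χ c = true <;> simp [hc]
  have ht : ∀ A : List (ℤ × ℤ), total χ (A.map take) = 0 := by
    intro A
    simp [total, Function.comp_def, score]
  rw [sweep, total_append, total_flatMap, h3, gainSum, ← h1, ← h2, sub_neg_eq_add,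
    ← List.sum_map_add]
  congr 1
  · congr 2 with s
    rw [total_append, total_append, total_append, ht]
    simp [total, score, Function.comp_def]
  · simp [total, score, Function.comp_def, polyValue]

/-- A verified sweep bounds the corresponding weighted sum over every packing. -/
theorem gainSum_le {dom χ : ℤ × ℤ → Bool} (hχ : CrossPacking χ)
    (hdom : ∀ c, χ c = true → dom c = true) {key late : ℤ × ℤ → ℤ} {active : ℤ → ℤ × ℤ → Bool}
    {L : List ℤ} {centres gaps : List (ℤ × ℤ)} {gains : List ((ℤ × ℤ) × ℤ)}
    {bdry : List (List (ℤ × ℤ) × ℤ)} {K : ℤ}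
    (h : (decide (L.Nodup) && gains.all (fun g => decide (key g.1 ∈ L)) &&
      gaps.all (fun c => decide (late c ∈ L)) &&
      (run dom (sweep key late active L centres gaps gains bdry)).2.boundedBy K) = true) :
    gainSum χ gains - gapCount χ gaps + polyValue χ bdry ≤ K := by
  simp only [Bool.and_eq_true, decide_eq_true_eq, List.all_eq_true] at h
  rw [← total_sweep χ h.1.1.1 h.1.1.2 h.1.2]
  exact total_le hχ hdom _ h.2

end SweepOp

/-! ### Potentials and local inequalities at edges and corners. -/

/-- The cells of the box with rows `1, …, a` and columns `1, …, b` that satisfy a condition. -/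
def boxCells (a b : ℕ) (f : ℤ × ℤ → Bool) : List (ℤ × ℤ) :=
  ((List.range a).flatMap fun i : ℕ => (List.range b).map fun j : ℕ => ((i : ℤ) + 1, (j : ℤ) + 1)).filter f

/-- A potential for the edge of the triangle in row `1`, as a polynomial in the indicators of the
cells in columns `9` and `10`. -/
def rowPotential : List (List (ℤ × ℤ) × ℤ) :=
  [([(1, 9)], 2), ([(2, 9)], 2), ([(3, 9)], 2), ([(4, 9)], 1), ([(1, 10)], 1), ([(2, 10)], 1),
    ([(3, 10)], 1), ([(1, 9), (4, 9)], -1), ([(1, 9), (3, 10)], -1), ([(2, 9), (4, 10)], -1),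
    ([(3, 9), (1, 10)], -2), ([(4, 9), (1, 10)], -1)]

/-- A potential for the diagonal edge of the triangle, as a polynomial in the indicators of the
cells on the antidiagonals `12` and `13`. -/
def diagPotential : List (List (ℤ × ℤ) × ℤ) :=
  [([(3, 9)], -1), ([(6, 7)], -1), ([(3, 10)], -1), ([(5, 7), (4, 9)], -1), ([(5, 7), (3, 10)], -1),
    ([(4, 8), (6, 7)], -1), ([(4, 8), (3, 10)], 2), ([(3, 9), (6, 7)], 1), ([(3, 9), (5, 8)], 1)]

/-- Apply a map to the cells in a polynomial. -/
def mapPoly (e : ℤ × ℤ → ℤ × ℤ) (P : List (List (ℤ × ℤ) × ℤ)) : List (List (ℤ × ℤ) × ℤ) :=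
  P.map fun b => (b.1.map e, b.2)

/-- The negative of a polynomial. -/
def negPoly (P : List (List (ℤ × ℤ) × ℤ)) : List (List (ℤ × ℤ) × ℤ) :=
  P.map fun b => (b.1, -b.2)

open SweepOp

/-- The part of the triangle near its acute corner. -/
def acuteGaps : List (ℤ × ℤ) :=
  boxCells 5 9 fun c => decide (c.1 < c.2 ∧ (c.1 ≤ 3 ∨ c.1 + c.2 ≤ 12 ∧ c.2 ≤ c.1 + 6))

/-- The part of the triangle near its right-angled corner. -/
def rightGaps : List (ℤ × ℤ) :=
  boxCells 6 6 fun c => decide (c.1 ≤ 3 ∨ c.2 ≤ 3 ∨ (c.1 ≤ 5 ∧ c.2 ≤ 5))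

/-- The weights of the boundary cells near the acute corner. -/
def acuteGains : List ((ℤ × ℤ) × ℤ) :=
  (List.range 8).map (fun j : ℕ => ((1, (j : ℤ) + 2), 1)) ++
    (List.range 5).map (fun i : ℕ => (((i : ℤ) + 1, (i : ℤ) + 2), 2))

/-- The weights of the boundary cells near the right-angled corner. -/
def rightGains : List ((ℤ × ℤ) × ℤ) :=
  (List.range 6).map (fun j : ℕ => ((1, (j : ℤ) + 1), 1)) ++
    (List.range 6).map (fun j : ℕ => (((j : ℤ) + 1, 1), 1))

/-- One step along the edge in row 1: the potential at columns 9, 10 minus its translate at columns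
10, 11 pays for the gain in column 10. This inequality and its analogues below are all that is used
of the coefficients. With a single key, the whole window is enumerated before any weight is added.
-/
theorem rowStep_le {χ : ℤ × ℤ → Bool} (hχ : CrossPacking χ) (hdom : ∀ c, χ c = true → 1 ≤ c.1) :
    gainSum χ [((1, 10), 1)] - gapCount χ [(1, 10), (2, 10), (3, 10)] +
      polyValue χ (rowPotential ++ negPoly (mapPoly (fun c => (c.1, c.2 + 1)) rowPotential)) ≤ 0 :=
  gainSum_le (dom := fun c => decide (1 ≤ c.1)) (key := fun _ => 0) (late := fun _ => 0)
    (active := fun _ _ => true) (L := [0])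
    (centres := boxCells 4 11 fun c => decide (9 ≤ c.2)) hχ (by simpa using hdom)
    (by decide +kernel)

theorem diagStep_le {χ : ℤ × ℤ → Bool} (hχ : CrossPacking χ)
    (hdom : ∀ c, χ c = true → c.1 < c.2) :
    gainSum χ [((6, 7), 2)] - gapCount χ [(6, 7), (5, 8), (4, 9), (6, 8), (5, 9), (4, 10)] +
      polyValue χ (diagPotential ++
        negPoly (mapPoly (fun c => (c.1 + 1, c.2 + 1)) diagPotential)) ≤ 0 :=
  gainSum_le (dom := fun c => decide (c.1 < c.2)) (key := fun _ => 0) (late := fun _ => 0)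
    (active := fun _ _ => true) (L := [0])
    (centres := boxCells 7 11 fun c => decide (c.1 < c.2 ∧ c.2 ≤ c.1 + 7 ∧ 12 ≤ c.1 + c.2 ∧
      c.1 + c.2 ≤ 15)) hχ (by simpa using hdom)
    (by decide +kernel)

/-- The potentials started at the two acute corners run towards each other along the diagonal edge.
The reflection exchanges antidiagonals 12 and 14 and fixes 13, so here they meet on antidiagonal 13.
-/
theorem diagJunction_le {χ : ℤ × ℤ → Bool} (hχ : CrossPacking χ)
    (hdom : ∀ c, χ c = true → c.1 < c.2) :
    gainSum χ [((6, 7), 2)] - gapCount χ [(6, 7), (5, 8), (4, 9)] +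
      polyValue χ (diagPotential ++
        mapPoly (fun c => (13 - c.2, 13 - c.1)) diagPotential) ≤ -1 :=
  gainSum_le (dom := fun c => decide (c.1 < c.2)) (key := fun _ => 0) (late := fun _ => 0)
    (active := fun _ _ => true) (L := [0])
    (centres := boxCells 6 10 fun c => decide (c.1 < c.2 ∧ c.2 ≤ c.1 + 7 ∧ 12 ≤ c.1 + c.2 ∧
      c.1 + c.2 ≤ 14)) hχ (by simpa using hdom)
    (by decide +kernel)

/-- Two edges leave the corner, and the negative potentials cancel the initial terms of their
telescoping sums. The sweep goes by antidiagonals: a gap is decided one antidiagonal later, and only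
the last two antidiagonals and the cells of the potentials stay active. -/
theorem acuteCorner_le {χ : ℤ × ℤ → Bool} (hχ : CrossPacking χ)
    (hdom : ∀ c, χ c = true → 1 ≤ c.1 ∧ c.1 < c.2) :
    gainSum χ acuteGains - gapCount χ acuteGaps +
      polyValue χ (negPoly rowPotential ++ negPoly diagPotential) ≤ 4 :=
  gainSum_le (dom := fun c => decide (1 ≤ c.1 ∧ c.1 < c.2)) (key := fun c => c.1 + c.2)
    (late := fun c => c.1 + c.2 + 1)
    (active := fun s c => decide (s ≤ c.1 + c.2 + 1 ∨ 9 ≤ c.2 ∨ 12 ≤ c.1 + c.2))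
    (L := (List.range 12).map fun s : ℕ => (s : ℤ) + 3)
    (centres := boxCells 6 10 fun c => decide (c.1 < c.2 ∧ (c.1 ≤ 4 ∨ c.1 + c.2 ≤ 13))) hχ
    (by simpa using hdom) (by decide +kernel)

/-- The corner is moved to `(1, 1)`, and both legs end here, each contributing its final potential.
The cell `(1, 1)` occurs twice in `rightGains`, since its cross overhangs both legs. -/
theorem rightCorner_le {χ : ℤ × ℤ → Bool} (hχ : CrossPacking χ)
    (hdom : ∀ c, χ c = true → 1 ≤ c.1 ∧ 1 ≤ c.2) :
    gainSum χ rightGains - gapCount χ rightGaps +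
      polyValue χ (mapPoly (fun c => (16 - c.2, c.1)) rowPotential ++
        mapPoly (fun c => (c.1, 16 - c.2)) rowPotential) ≤ 4 :=
  gainSum_le (dom := fun c => decide (1 ≤ c.1 ∧ 1 ≤ c.2)) (key := fun c => c.1 - c.2)
    (late := fun c => c.1 - c.2 + 1)
    (active := fun s c => decide (s ≤ c.1 - c.2 + 1 ∨ (6 ≤ c.2 ∧ c.1 ≤ 4) ∨ (6 ≤ c.1 ∧ c.2 ≤ 4)))
    (L := (List.range 14).map fun s : ℕ => (s : ℤ) - 6)
    (centres := boxCells 7 7 fun c => decide ((c.1 ≤ 4 ∨ c.2 ≤ 4 ∨ c.1 + c.2 ≤ 11))) hχ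
    (by simpa using hdom) (by decide +kernel)

/-! ### Transport by isometries and sums of gaps. -/

/-- A surjective map of cells that preserves the lattice distance. -/
def IsCellIsometry (e : ℤ × ℤ → ℤ × ℤ) : Prop :=
  Function.Surjective e ∧ ∀ p q, ((e p).1 - (e q).1).natAbs + ((e p).2 - (e q).2).natAbs =
    (p.1 - q.1).natAbs + (p.2 - q.2).natAbs

theorem isCellIsometry_translate (a b : ℤ) : IsCellIsometry fun c => (c.1 + a, c.2 + b) :=
  ⟨fun q => ⟨(q.1 - a, q.2 - b), by simp⟩, fun p q => by dsimp only; omega⟩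

theorem isCellIsometry_mirror (M : ℤ) : IsCellIsometry fun c => (M - c.2, M - c.1) :=
  ⟨fun q => ⟨(M - q.2, M - q.1), by simp⟩, fun p q => by dsimp only; omega⟩

theorem isCellIsometry_flip (M : ℤ) : IsCellIsometry fun c => (c.1, M - c.2) :=
  ⟨fun q => ⟨(q.1, M - q.2), by simp⟩, fun p q => by dsimp only; omega⟩

theorem mem_cross {c q : ℤ × ℤ} :
    q ∈ cross c ↔ (c.1 - q.1).natAbs + (c.2 - q.2).natAbs ≤ 1 := by
  obtain ⟨a, b⟩ := c
  obtain ⟨x, y⟩ := q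
  simp only [cross, List.mem_cons, Prod.mk.injEq, List.not_mem_nil, or_false]
  omega

theorem uncovered_iff {χ : ℤ × ℤ → Bool} {c : ℤ × ℤ} :
    uncovered χ c = true ↔
      ∀ q, (c.1 - q.1).natAbs + (c.2 - q.2).natAbs ≤ 1 → χ q = false := by
  simp [uncovered, mem_cross]

/-- Surjectivity matters: every neighbour of `e c` must be the image of a neighbour of `c`. -/
theorem IsCellIsometry.uncovered_comp {e : ℤ × ℤ → ℤ × ℤ} (he : IsCellIsometry e)
    (χ : ℤ × ℤ → Bool) (c : ℤ × ℤ) : uncovered (χ ∘ e) c = uncovered χ (e c) := by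
  rw [Bool.eq_iff_iff, uncovered_iff, uncovered_iff]
  refine ⟨fun h q hq => ?_, fun h q hq => h _ (by rwa [he.2])⟩
  obtain ⟨p, rfl⟩ := he.1 q
  exact h p (by rwa [he.2] at hq)

theorem IsCellIsometry.gapCount_comp {e : ℤ × ℤ → ℤ × ℤ} (he : IsCellIsometry e)
    (χ : ℤ × ℤ → Bool) (l : List (ℤ × ℤ)) : gapCount (χ ∘ e) l = gapCount χ (l.map e) := by
  simp [gapCount, Function.comp_def, ← he.uncovered_comp]

theorem IsCellIsometry.crossPacking_comp {e : ℤ × ℤ → ℤ × ℤ} (he : IsCellIsometry e)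
    {χ : ℤ × ℤ → Bool} (hχ : CrossPacking χ) : CrossPacking (χ ∘ e) := by
  intro p q hp hq hpq
  have h := hχ _ _ hp hq (by
    rw [closeCells, decide_eq_true_eq] at hpq ⊢
    rwa [he.2])
  have h2 := he.2 p q
  rw [h] at h2
  ext <;> omega

theorem polyValue_append (χ : ℤ × ℤ → Bool) (P Q : List (List (ℤ × ℤ) × ℤ)) :
    polyValue χ (P ++ Q) = polyValue χ P + polyValue χ Q := by
  simp [polyValue]

theorem polyValue_mapPoly (χ : ℤ × ℤ → Bool) (e : ℤ × ℤ → ℤ × ℤ)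
    (P : List (List (ℤ × ℤ) × ℤ)) : polyValue χ (mapPoly e P) = polyValue (χ ∘ e) P := by
  rw [polyValue, polyValue, mapPoly, List.map_map]
  congr 2
  funext b
  simp only [Function.comp_apply, List.all_map]

theorem polyValue_negPoly (χ : ℤ × ℤ → Bool) (P : List (List (ℤ × ℤ) × ℤ)) :
    polyValue χ (negPoly P) = -polyValue χ P := by
  induction P with
  | nil => simp [polyValue, negPoly]
  | cons b P ih =>
    simp only [polyValue, negPoly, List.map_cons, List.sum_cons, List.map_map] at ih ⊢
    rw [ih, neg_add]
    congr 1
    by_cases h : b.1.all χ = true <;> simp [h]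

/-- The cells of the triangle of side `N`. -/
noncomputable def triangle (N : ℕ) : Finset (ℤ × ℤ) :=
  (Finset.Icc 1 (N : ℤ) ×ˢ Finset.Icc 1 (N : ℤ)).filter fun c => c.1 < c.2

theorem mem_triangle {N : ℕ} {c : ℤ × ℤ} :
    c ∈ triangle N ↔ 1 ≤ c.1 ∧ c.1 < c.2 ∧ c.2 ≤ N := by
  simp only [triangle, Finset.mem_filter, Finset.mem_product, Finset.mem_Icc]
  omega

/-- The indicator of a cell. -/
def indicator (χ : ℤ × ℤ → Bool) (c : ℤ × ℤ) : ℤ := if χ c then 1 else 0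

/-- The indicator of an uncovered cell. -/
def gapIndicator (χ : ℤ × ℤ → Bool) (c : ℤ × ℤ) : ℤ := if uncovered χ c then 1 else 0

theorem gapIndicator_nonneg (χ : ℤ × ℤ → Bool) (c : ℤ × ℤ) : 0 ≤ gapIndicator χ c := by
  rw [gapIndicator]
  split_ifs <;> simp

theorem gapCount_eq (χ : ℤ × ℤ → Bool) (l : List (ℤ × ℤ)) :
    gapCount χ l = (l.map (gapIndicator χ)).sum := rfl

theorem gapCount_le (χ : ℤ × ℤ → Bool) {l : List (ℤ × ℤ)} (hl : l.Nodup) {F : Finset (ℤ × ℤ)}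
    (h : ∀ c ∈ l, c ∈ F) : gapCount χ l ≤ ∑ c ∈ F, gapIndicator χ c := by
  rw [gapCount_eq, ← List.sum_toFinset _ hl]
  exact Finset.sum_le_sum_of_subset_of_nonneg (fun c hc => h c (by simpa using hc))
    fun c _ _ => gapIndicator_nonneg χ c

/-- The label recovers the index `k` from a cell, so the lists are disjoint and no gap is counted
twice. -/
theorem sum_gapCount_le (χ : ℤ × ℤ → Bool) {n : ℕ} {l : ℕ → List (ℤ × ℤ)}
    (hl : ∀ k < n, (l k).Nodup) {F : Finset (ℤ × ℤ)} (label : ℤ × ℤ → ℤ)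
    (h : ∀ k < n, ∀ c ∈ l k, c ∈ F ∧ label c = k) :
    ∑ k ∈ Finset.range n, gapCount χ (l k) ≤ ∑ c ∈ F, gapIndicator χ c := by
  calc ∑ k ∈ Finset.range n, gapCount χ (l k)
      ≤ ∑ k ∈ Finset.range n, ∑ c ∈ F with label c = (k : ℤ), gapIndicator χ c := by
        refine Finset.sum_le_sum fun k hk => ?_
        rw [Finset.mem_range] at hk
        exact gapCount_le χ (hl k hk) fun c hc => by simpa using h k hk c hc
    _ = ∑ m ∈ (Finset.range n).image (fun k : ℕ => (k : ℤ)),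
          ∑ c ∈ F with label c = m, gapIndicator χ c := by
        rw [Finset.sum_image]
        intro a _ b _ hab
        simpa using hab
    _ ≤ ∑ c ∈ F, gapIndicator χ c :=
        Finset.sum_fiberwise_le_sum_of_sum_fiber_nonneg fun m _ =>
          Finset.sum_nonneg fun c _ => gapIndicator_nonneg χ c

/-! ### Telescoping around the boundary of a large triangle. -/

section Annulus

variable {χ : ℤ × ℤ → Bool}

theorem sum_row_le (hχ : CrossPacking χ) (hdom : ∀ c, χ c = true → 1 ≤ c.1) (n : ℕ) :
    ∑ k ∈ Finset.range n, indicator χ (1, 10 + k) -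
      ∑ k ∈ Finset.range n, gapCount χ [(1, 10 + (k : ℤ)), (2, 10 + (k : ℤ)), (3, 10 + (k : ℤ))] +
      polyValue χ rowPotential - polyValue (χ ∘ fun c : ℤ × ℤ => (c.1 + 0, c.2 + (n : ℤ))) rowPotential ≤
        0 := by
  induction n with
  | zero => simp [Function.comp_def]
  | succ n ih =>
    have he := isCellIsometry_translate 0 (n : ℤ)
    have h := rowStep_le (he.crossPacking_comp hχ) fun c hc => by
      have := hdom _ hc
      simpa using this
    rw [he.gapCount_comp, polyValue_append, polyValue_negPoly, polyValue_mapPoly] at h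
    rw [Finset.sum_range_succ, Finset.sum_range_succ]
    have h1 : ((χ ∘ fun c : ℤ × ℤ => (c.1 + 0, c.2 + (n : ℤ))) ∘ fun c : ℤ × ℤ => (c.1, c.2 + 1)) =
        χ ∘ fun c : ℤ × ℤ => (c.1 + 0, c.2 + ((n + 1 : ℕ) : ℤ)) := by
      funext c
      simp [add_assoc, add_comm (1 : ℤ)]
    rw [h1] at h
    simp only [gainSum, List.map_cons, List.map_nil, List.sum_cons, List.sum_nil, add_zero,
      Function.comp] at h ih ⊢
    simp only [indicator] at ih ⊢
    linarith

theorem sum_diag_le (hχ : CrossPacking χ) (hdom : ∀ c, χ c = true → c.1 < c.2) (n : ℕ) :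
    ∑ k ∈ Finset.range n, 2 * indicator χ (6 + k, 7 + k) -
      ∑ k ∈ Finset.range n, gapCount χ
        ([(6, 7), (5, 8), (4, 9), (6, 8), (5, 9), (4, 10)].map fun c => (c.1 + (k : ℤ), c.2 + (k : ℤ))) +
      polyValue χ diagPotential -
      polyValue (χ ∘ fun c : ℤ × ℤ => (c.1 + (n : ℤ), c.2 + (n : ℤ))) diagPotential ≤ 0 := by
  induction n with
  | zero => simp [Function.comp_def]
  | succ n ih =>
    have he := isCellIsometry_translate (n : ℤ) (n : ℤ)
    have h := diagStep_le (he.crossPacking_comp hχ) fun c hc => by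
      have := hdom _ hc
      simpa using this
    rw [he.gapCount_comp, polyValue_append, polyValue_negPoly, polyValue_mapPoly] at h
    rw [Finset.sum_range_succ, Finset.sum_range_succ]
    have h1 : ((χ ∘ fun c : ℤ × ℤ => (c.1 + (n : ℤ), c.2 + (n : ℤ))) ∘ fun c : ℤ × ℤ => (c.1 + 1, c.2 + 1)) =
        χ ∘ fun c : ℤ × ℤ => (c.1 + ((n + 1 : ℕ) : ℤ), c.2 + ((n + 1 : ℕ) : ℤ)) := by
      funext c
      simp [add_assoc, add_comm (1 : ℤ)]
    rw [h1] at h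
    have h2 : gainSum (χ ∘ fun c : ℤ × ℤ => (c.1 + (n : ℤ), c.2 + (n : ℤ))) [((6, 7), 2)] =
        2 * indicator χ (6 + n, 7 + n) := by
      simp [gainSum, indicator]
    rw [h2] at h
    linarith

end Annulus

theorem mem_acuteGaps : ∀ c ∈ acuteGaps,
    1 ≤ c.1 ∧ c.1 < c.2 ∧ (c.1 ≤ 3 ∧ c.2 ≤ 9 ∨ c.1 + c.2 ≤ 12 ∧ c.2 ≤ c.1 + 6) := by
  decide +kernel

theorem mem_rightGaps : ∀ c ∈ rightGaps, 1 ≤ c.1 ∧ 1 ≤ c.2 ∧ c.1 ≤ 6 ∧ c.2 ≤ 6 ∧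
    (c.1 ≤ 3 ∨ c.2 ≤ 3 ∨ c.1 ≤ 5 ∧ c.2 ≤ 5) := by
  decide +kernel

theorem IsCellIsometry.injective {e : ℤ × ℤ → ℤ × ℤ} (he : IsCellIsometry e) :
    Function.Injective e := by
  intro p q h
  have := he.2 p q
  rw [h] at this
  ext <;> omega

/-- The local inequalities may be added because their gap regions (three corners, two legs, the
diagonal strip and the junction) are disjoint once the side is at least 16. Each region is described
by linear conditions, and disjointness is checked cell by cell. -/
theorem sum_gapCount_regions_le (χ : ℤ × ℤ → Bool) (m : ℕ) :
    gapCount χ acuteGaps +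
      gapCount χ (acuteGaps.map fun c => ((m : ℤ) + 17 - c.2, (m : ℤ) + 17 - c.1)) +
      gapCount χ (rightGaps.map fun c => (c.1, (m : ℤ) + 17 - c.2)) +
      ∑ k ∈ Finset.range (m + 1),
        gapCount χ [(1, 10 + (k : ℤ)), (2, 10 + (k : ℤ)), (3, 10 + (k : ℤ))] +
      ∑ k ∈ Finset.range (m + 1),
        gapCount χ ([(1, 10 + (k : ℤ)), (2, 10 + (k : ℤ)), (3, 10 + (k : ℤ))].map
          fun c => ((m : ℤ) + 17 - c.2, (m : ℤ) + 17 - c.1)) +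
      ∑ k ∈ Finset.range (m + 4), gapCount χ
        ([(6, 7), (5, 8), (4, 9), (6, 8), (5, 9), (4, 10)].map
          fun c => (c.1 + (k : ℤ), c.2 + (k : ℤ))) +
      gapCount χ ([(6, 7), (5, 8), (4, 9)].map
          fun c => (c.1 + ((m + 4 : ℕ) : ℤ), c.2 + ((m + 4 : ℕ) : ℤ))) ≤
    ∑ c ∈ triangle (m + 16), gapIndicator χ c := by
  have hμ := isCellIsometry_mirror ((m : ℤ) + 17)
  have hρ := isCellIsometry_flip ((m : ℤ) + 17)
  have n1 : acuteGaps.Nodup := by decide +kernel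
  have n2 : rightGaps.Nodup := by decide +kernel
  have B1 := gapCount_le χ (F := (triangle (m + 16)).filter fun c =>
    c.1 ≤ 3 ∧ c.2 ≤ 9 ∨ c.1 + c.2 ≤ 12 ∧ c.2 ≤ c.1 + 6) n1 fun c hc => by
      have := mem_acuteGaps c hc
      simp only [Finset.mem_filter, mem_triangle]
      push_cast
      omega
  have B2 := gapCount_le χ (F := (triangle (m + 16)).filter fun c =>
    (m : ℤ) + 14 ≤ c.2 ∧ m + 8 ≤ c.1 ∨ 2 * (m : ℤ) + 22 ≤ c.1 + c.2 ∧ c.2 ≤ c.1 + 6)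
    (n1.map hμ.injective) fun c hc => by
      obtain ⟨d, hd, rfl⟩ := List.mem_map.mp hc
      have := mem_acuteGaps d hd
      simp only [Finset.mem_filter, mem_triangle]
      push_cast
      omega
  have B3 := gapCount_le χ (F := (triangle (m + 16)).filter fun c =>
    c.1 ≤ 6 ∧ (m : ℤ) + 11 ≤ c.2 ∧ (c.1 ≤ 3 ∨ m + 14 ≤ c.2 ∨ c.1 ≤ 5 ∧ m + 12 ≤ c.2))
    (n2.map hρ.injective) fun c hc => by
      obtain ⟨d, hd, rfl⟩ := List.mem_map.mp hc
      have := mem_rightGaps d hd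
      simp only [Finset.mem_filter, mem_triangle]
      push_cast
      omega
  have B4 := sum_gapCount_le χ (n := m + 1) (F := (triangle (m + 16)).filter fun c =>
    c.1 ≤ 3 ∧ 10 ≤ c.2 ∧ c.2 ≤ (m : ℤ) + 10)
    (l := fun k => [(1, 10 + (k : ℤ)), (2, 10 + (k : ℤ)), (3, 10 + (k : ℤ))])
    (fun k _ => by simp) (fun c => c.2 - 10) fun k hk c hc => by
      simp only [List.mem_cons, List.not_mem_nil, or_false] at hc
      rw [Finset.mem_filter, mem_triangle]
      push_cast
      rcases hc with rfl | rfl | rfl <;> dsimp only <;> omega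
  have B5 := sum_gapCount_le χ (n := m + 1) (F := (triangle (m + 16)).filter fun c =>
    (m : ℤ) + 14 ≤ c.2 ∧ 7 ≤ c.1 ∧ c.1 ≤ (m : ℤ) + 7)
    (l := fun k => [(1, 10 + (k : ℤ)), (2, 10 + (k : ℤ)), (3, 10 + (k : ℤ))].map
      fun c => ((m : ℤ) + 17 - c.2, (m : ℤ) + 17 - c.1))
    (fun k _ => by simp) (fun c => m + 7 - c.1) fun k hk c hc => by
      simp only [List.map_cons, List.map_nil, List.mem_cons, List.not_mem_nil, or_false] at hc
      rw [Finset.mem_filter, mem_triangle]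
      push_cast
      rcases hc with rfl | rfl | rfl <;> dsimp only <;> omega
  have B6 := sum_gapCount_le χ (n := m + 4) (F := (triangle (m + 16)).filter fun c =>
    c.2 ≤ c.1 + 6 ∧ 13 ≤ c.1 + c.2 ∧ c.1 + c.2 ≤ 2 * (m : ℤ) + 20)
    (l := fun k => [(6, 7), (5, 8), (4, 9), (6, 8), (5, 9), (4, 10)].map
      fun c => (c.1 + (k : ℤ), c.2 + (k : ℤ)))
    (fun k _ => (show List.Nodup _ by decide).map
      (isCellIsometry_translate (k : ℤ) (k : ℤ)).injective)
    (fun c => (c.1 + c.2 - 13) / 2) fun k hk c hc => by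
      simp only [List.map_cons, List.map_nil, List.mem_cons, List.not_mem_nil, or_false] at hc
      rw [Finset.mem_filter, mem_triangle]
      push_cast
      rcases hc with rfl | rfl | rfl | rfl | rfl | rfl <;> dsimp only <;> omega
  have B7 := gapCount_le χ (l := [(6, 7), (5, 8), (4, 9)].map
      fun c => (c.1 + ((m + 4 : ℕ) : ℤ), c.2 + ((m + 4 : ℕ) : ℤ)))
    (F := (triangle (m + 16)).filter fun c => c.2 ≤ c.1 + 6 ∧ c.1 + c.2 = 2 * (m : ℤ) + 21)
    ((show List.Nodup _ by decide).map
      (isCellIsometry_translate ((m + 4 : ℕ) : ℤ) ((m + 4 : ℕ) : ℤ)).injective) fun c hc => by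
      simp only [List.map_cons, List.map_nil, List.mem_cons, List.not_mem_nil, or_false] at hc
      rw [Finset.mem_filter, mem_triangle]
      push_cast at hc ⊢
      rcases hc with rfl | rfl | rfl <;> dsimp only <;> omega
  refine (add_le_add (add_le_add (add_le_add (add_le_add (add_le_add (add_le_add
    B1 B2) B3) B4) B5) B6) B7).trans ?_
  simp only [Finset.sum_filter, ← Finset.sum_add_distrib]
  refine Finset.sum_le_sum fun c hc => ?_
  rw [mem_triangle] at hc
  have h0 := gapIndicator_nonneg χ c
  push_cast at hc
  generalize gapIndicator χ c = u at h0 ⊢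
  split_ifs <;> omega

theorem gainSum_append (χ : ℤ × ℤ → Bool) (A B : List ((ℤ × ℤ) × ℤ)) :
    gainSum χ (A ++ B) = gainSum χ A + gainSum χ B := by
  simp [gainSum]

theorem gainSum_map_range (χ : ℤ × ℤ → Bool) (f : ℕ → ℤ × ℤ) (w : ℤ) (n : ℕ) :
    gainSum χ ((List.range n).map fun k => (f k, w)) =
      ∑ k ∈ Finset.range n, w * indicator χ (f k) := by
  induction n with
  | zero => simp [gainSum]
  | succ n ih =>
    rw [List.range_succ, List.map_append, gainSum_append, ih, Finset.sum_range_succ]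
    simp [gainSum, indicator]

/-- The gain of a packing at the boundary of a large triangle exceeds the number of its uncovered
cells by at most eleven. -/
theorem sum_boundary_le {χ : ℤ × ℤ → Bool} {m : ℕ} (hχ : CrossPacking χ)
    (hT : ∀ c, χ c = true → c ∈ triangle (m + 16)) :
    ∑ k ∈ Finset.range (m + 15), indicator χ (1, k + 2) +
      ∑ k ∈ Finset.range (m + 15), indicator χ (k + 1, m + 16) +
      ∑ k ∈ Finset.range (m + 15), 2 * indicator χ (k + 1, k + 2) ≤
    11 + ∑ c ∈ triangle (m + 16), gapIndicator χ c := by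
  simp only [mem_triangle, Nat.cast_add, Nat.cast_ofNat] at hT
  have hμ := isCellIsometry_mirror ((m : ℤ) + 17)
  have hρ := isCellIsometry_flip ((m : ℤ) + 17)
  set χ' := χ ∘ fun c : ℤ × ℤ => ((m : ℤ) + 17 - c.2, (m : ℤ) + 17 - c.1) with hχ'
  have hp' : CrossPacking χ' := hμ.crossPacking_comp hχ
  have hT' : ∀ c, χ' c = true → 1 ≤ c.1 ∧ c.1 < c.2 ∧ c.2 ≤ (m : ℤ) + 16 := fun c hc => by
    have := hT _ hc
    dsimp only at this
    omega
  -- the inequalities along the boundary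
  have A1 := acuteCorner_le hχ fun c hc => ⟨(hT c hc).1, (hT c hc).2.1⟩
  have A2 := acuteCorner_le hp' fun c hc => ⟨(hT' c hc).1, (hT' c hc).2.1⟩
  have A3 := rightCorner_le (hρ.crossPacking_comp hχ) fun c hc => by
    have := hT _ hc
    dsimp only at this
    omega
  have A4 := sum_row_le hχ (fun c hc => (hT c hc).1) (m + 1)
  have A5 := sum_row_le hp' (fun c hc => (hT' c hc).1) (m + 1)
  have A6 := sum_diag_le hχ (fun c hc => (hT c hc).2.1) (m + 4)
  have hσ := isCellIsometry_translate (((m + 4 : ℕ) : ℤ)) (((m + 4 : ℕ) : ℤ))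
  have A7 := diagJunction_le (hσ.crossPacking_comp hχ) fun c hc => by
    have := hT _ hc
    dsimp only at this
    omega
  simp only [polyValue_append, polyValue_negPoly, polyValue_mapPoly] at A1 A2 A3 A7
  -- The potentials at the right-angled corner and at the junction are those at which the
  -- telescoping sums end, or with which the mirrored acute corner begins.
  have e1 : ((χ ∘ fun c : ℤ × ℤ => (c.1, (m : ℤ) + 17 - c.2)) ∘ fun c => (16 - c.2, c.1)) =
      χ' ∘ fun c : ℤ × ℤ => (c.1 + 0, c.2 + ((m + 1 : ℕ) : ℤ)) := by
    funext c
    simp only [Function.comp, hχ']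
    congr 2 <;> push_cast <;> ring
  have e2 : ((χ ∘ fun c : ℤ × ℤ => (c.1, (m : ℤ) + 17 - c.2)) ∘ fun c => (c.1, 16 - c.2)) =
      χ ∘ fun c : ℤ × ℤ => (c.1 + 0, c.2 + ((m + 1 : ℕ) : ℤ)) := by
    funext c
    simp only [Function.comp]
    congr 2 <;> push_cast <;> ring
  have e3 : ((χ ∘ fun c : ℤ × ℤ => (c.1 + ((m + 4 : ℕ) : ℤ), c.2 + ((m + 4 : ℕ) : ℤ))) ∘
      fun c => (13 - c.2, 13 - c.1)) = χ' := by
    funext c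
    simp only [Function.comp, hχ']
    congr 2 <;> push_cast <;> ring
  rw [e1, e2] at A3
  rw [e3, hσ.gapCount_comp] at A7
  rw [hρ.gapCount_comp] at A3
  rw [hχ', hμ.gapCount_comp, ← hχ'] at A2
  have G := sum_gapCount_regions_le χ m
  have A5' : ∑ k ∈ Finset.range (m + 1),
      gapCount χ' [(1, 10 + (k : ℤ)), (2, 10 + (k : ℤ)), (3, 10 + (k : ℤ))] =
      ∑ k ∈ Finset.range (m + 1),
        gapCount χ ([(1, 10 + (k : ℤ)), (2, 10 + (k : ℤ)), (3, 10 + (k : ℤ))].map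
          fun c => ((m : ℤ) + 17 - c.2, (m : ℤ) + 17 - c.1)) :=
    Finset.sum_congr rfl fun k _ => hμ.gapCount_comp χ _
  rw [A5'] at A5
  -- the gains at the three edges
  have g1 : gainSum χ acuteGains = ∑ k ∈ Finset.range 8, indicator χ (1, k + 2) +
      ∑ k ∈ Finset.range 5, 2 * indicator χ (k + 1, k + 2) := by
    rw [acuteGains, gainSum_append, gainSum_map_range, gainSum_map_range]
    simp only [one_mul]
  have g2 : gainSum χ' acuteGains =
      ∑ k ∈ Finset.range 8, indicator χ (m + 8 + k, m + 16) +
      ∑ k ∈ Finset.range 5, 2 * indicator χ (m + 11 + k, m + 12 + k) := by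
    rw [acuteGains, gainSum_append, gainSum_map_range, gainSum_map_range,
      ← Finset.sum_range_reflect _ 8, ← Finset.sum_range_reflect _ 5]
    simp only [one_mul]
    congr 1 <;> refine Finset.sum_congr rfl fun k hk => ?_ <;> rw [Finset.mem_range] at hk
    · rw [indicator, indicator, hχ', Function.comp]
      congr 4 <;> omega
    · rw [indicator, indicator, hχ', Function.comp]
      congr 5 <;> omega
  have g3 : gainSum (χ ∘ fun c : ℤ × ℤ => (c.1, (m : ℤ) + 17 - c.2)) rightGains =
      ∑ k ∈ Finset.range 6, indicator χ (1, m + 11 + k) +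
      ∑ k ∈ Finset.range 6, indicator χ (k + 1, m + 16) := by
    rw [rightGains, gainSum_append, gainSum_map_range, gainSum_map_range,
      ← Finset.sum_range_reflect _ 6]
    simp only [one_mul]
    congr 1 <;> refine Finset.sum_congr rfl fun k hk => ?_ <;> rw [Finset.mem_range] at hk
    · rw [indicator, indicator, Function.comp]
      congr 4
      omega
    · rw [indicator, indicator, Function.comp]
      congr 4
      omega
  have g7 : gainSum (χ ∘ fun c : ℤ × ℤ => (c.1 + ((m + 4 : ℕ) : ℤ), c.2 + ((m + 4 : ℕ) : ℤ)))
      [((6, 7), 2)] = 2 * indicator χ (m + 10, m + 11) := by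
    have h6 : (6 : ℤ) + (m + 4) = m + 10 := by ring
    have h7 : (7 : ℤ) + (m + 4) = m + 11 := by ring
    simp [gainSum, indicator, h6, h7]
  have r1 : ∑ k ∈ Finset.range (m + 15), indicator χ (1, k + 2) =
      ∑ k ∈ Finset.range 8, indicator χ (1, k + 2) +
      ∑ k ∈ Finset.range (m + 1), indicator χ (1, 10 + k) +
      ∑ k ∈ Finset.range 6, indicator χ (1, m + 11 + k) := by
    rw [show m + 15 = 8 + (m + 1) + 6 by ring, Finset.sum_range_add, Finset.sum_range_add]
    congr 1
    · congr 1
      refine Finset.sum_congr rfl fun k _ => ?_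
      congr 2
      omega
    · refine Finset.sum_congr rfl fun k _ => ?_
      congr 2
      omega
  have r2 : ∑ k ∈ Finset.range (m + 15), indicator χ (k + 1, m + 16) =
      ∑ k ∈ Finset.range 6, indicator χ (k + 1, m + 16) +
      ∑ k ∈ Finset.range (m + 1), indicator χ' (1, 10 + k) +
      ∑ k ∈ Finset.range 8, indicator χ (m + 8 + k, m + 16) := by
    rw [show m + 15 = 6 + (m + 1) + 8 by ring, Finset.sum_range_add, Finset.sum_range_add]
    congr 1
    · congr 1
      rw [← Finset.sum_range_reflect]
      refine Finset.sum_congr rfl fun k hk => ?_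
      rw [Finset.mem_range] at hk
      rw [indicator, indicator, hχ', Function.comp]
      congr 4 <;> omega
    · refine Finset.sum_congr rfl fun k _ => ?_
      congr 2
      omega
  have r3 : ∑ k ∈ Finset.range (m + 15), 2 * indicator χ (k + 1, k + 2) =
      ∑ k ∈ Finset.range 5, 2 * indicator χ (k + 1, k + 2) +
      ∑ k ∈ Finset.range (m + 4), 2 * indicator χ (6 + k, 7 + k) +
      2 * indicator χ (m + 10, m + 11) +
      ∑ k ∈ Finset.range 5, 2 * indicator χ (m + 11 + k, m + 12 + k) := by
    rw [show m + 15 = 5 + (m + 4) + 1 + 5 by ring, Finset.sum_range_add, Finset.sum_range_add,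
      Finset.sum_range_add, Finset.sum_range_one]
    congr 1
    · congr 1
      · congr 1
        refine Finset.sum_congr rfl fun k _ => ?_
        congr 3 <;> omega
      · congr 3 <;> omega
    · refine Finset.sum_congr rfl fun k _ => ?_
      congr 3 <;> omega
  -- All potentials cancel; the constants add up to 4 + 4 + 4 - 1 = 11.
  linarith

/-! ### Counting cells: the upper bound for large triangles. -/

theorem two_mul_card_triangle (N : ℕ) : 2 * (triangle N).card = N * (N - 1) := by
  induction N with
  | zero => simp [triangle]
  | succ N ih =>
    have h : triangle (N + 1) = triangle N ∪ Finset.Icc 1 (N : ℤ) ×ˢ {(N : ℤ) + 1} := by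
      ext c
      simp only [Finset.mem_union, mem_triangle, Finset.mem_product, Finset.mem_Icc,
        Finset.mem_singleton]
      push_cast
      omega
    have hd : Disjoint (triangle N) (Finset.Icc 1 (N : ℤ) ×ˢ {(N : ℤ) + 1}) := by
      rw [Finset.disjoint_left]
      intro c hc
      simp only [mem_triangle, Finset.mem_product, Finset.mem_Icc, Finset.mem_singleton] at hc ⊢
      omega
    rw [h, Finset.card_union_of_disjoint hd, mul_add, ih]
    cases N with
    | zero => simp
    | succ n =>
      simp
      ring

/-- The number of cells of the cross centred at `c` that lie outside the triangle of side `N`. -/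
def outside (N : ℕ) (c : ℤ × ℤ) : ℕ :=
  (if c.1 = 1 then 1 else 0) + (if c.2 = N then 1 else 0) + (if c.2 = c.1 + 1 then 2 else 0)

theorem five_le_card_cross {N : ℕ} {c : ℤ × ℤ} (hc : c ∈ triangle N) :
    5 ≤ ((cross c).toFinset ∩ triangle N).card + outside N c := by
  have h5 : (cross c).toFinset.card = 5 := by
    rw [List.toFinset_card_of_nodup]
    · simp [cross]
    · simp only [cross, List.nodup_cons, List.mem_cons, Prod.ext_iff, List.not_mem_nil, or_false,
        not_false_eq_true, List.nodup_nil, and_true]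
      omega
  have h : (cross c).toFinset \ triangle N ⊆ (if c.1 = 1 then {(c.1 - 1, c.2)} else ∅) ∪
      (if c.2 = N then {(c.1, c.2 + 1)} else ∅) ∪
      (if c.2 = c.1 + 1 then {(c.1 + 1, c.2), (c.1, c.2 - 1)} else ∅) := by
    intro q hq
    rw [mem_triangle] at hc
    simp only [Finset.mem_sdiff, List.mem_toFinset, mem_triangle, cross, List.mem_cons,
      List.not_mem_nil, or_false] at hq
    obtain ⟨h1, h2⟩ := hq
    simp only [Finset.mem_union]
    rcases h1 with rfl | rfl | rfl | rfl | rfl <;> try dsimp only at h2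
    · omega
    · rw [if_pos (by omega : c.1 = 1)]
      simp
    · rw [if_pos (by omega : c.2 = c.1 + 1)]
      simp
    · rw [if_pos (by omega : c.2 = c.1 + 1)]
      simp
    · rw [if_pos (by omega : c.2 = (N : ℤ))]
      simp
  have h1 : ((cross c).toFinset \ triangle N).card ≤ outside N c := by
    refine (Finset.card_le_card h).trans ((Finset.card_union_le _ _).trans ?_)
    refine add_le_add ((Finset.card_union_le _ _).trans (add_le_add ?_ ?_)) ?_
    · split_ifs <;> simp
    · split_ifs <;> simp
    · split_ifs
      · exact Finset.card_le_two
      · simp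
  have h2 := Finset.card_inter_add_card_sdiff (cross c).toFinset (triangle N)
  omega

/-- The parts of the crosses inside the triangle are disjoint and avoid the uncovered cells; what
each lacks of five cells is at most `outside`. -/
theorem five_mul_card_le {N : ℕ} {S : Finset (ℤ × ℤ)} (hS : S ⊆ triangle N)
    (hp : CrossPacking fun c => decide (c ∈ S)) :
    5 * (S.card : ℤ) + ∑ c ∈ triangle N, gapIndicator (fun c => decide (c ∈ S)) c ≤
      (triangle N).card + ∑ c ∈ S, (outside N c : ℤ) := by
  set χ : ℤ × ℤ → Bool := fun c => decide (c ∈ S)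
  have hd : (S : Set (ℤ × ℤ)).PairwiseDisjoint fun c => (cross c).toFinset ∩ triangle N := by
    intro p hpS q hqS hpq
    rw [Function.onFun, Finset.disjoint_left]
    intro r hr hr'
    simp only [Finset.mem_inter, List.mem_toFinset, mem_cross] at hr hr'
    refine hpq (hp p q (by simpa [χ] using hpS) (by simpa [χ] using hqS) ?_)
    rw [closeCells, decide_eq_true_eq]
    omega
  have hcard := Finset.card_biUnion hd
  have hsub : S.biUnion (fun c => (cross c).toFinset ∩ triangle N) ⊆
      (triangle N).filter fun c => ¬ uncovered χ c = true := by
    intro r hr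
    simp only [Finset.mem_biUnion, Finset.mem_inter, List.mem_toFinset, mem_cross] at hr
    obtain ⟨p, hpS, hr, hrT⟩ := hr
    rw [Finset.mem_filter]
    refine ⟨hrT, fun h => ?_⟩
    rw [uncovered_iff] at h
    have := h p (by omega)
    simp [χ, hpS] at this
  have h1 := Finset.card_le_card hsub
  have h2 := Finset.card_filter_add_card_filter_not (s := triangle N) fun c => uncovered χ c = true
  have h3 : ∑ c ∈ triangle N, gapIndicator χ c =
      ((triangle N).filter fun c => uncovered χ c = true).card := by
    rw [Finset.card_filter]
    push_cast
    rfl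
  have h4 : 5 * S.card ≤ ∑ c ∈ S, ((cross c).toFinset ∩ triangle N).card +
      ∑ c ∈ S, outside N c := by
    rw [← Finset.sum_add_distrib, mul_comm, ← smul_eq_mul, ← Finset.sum_const]
    exact Finset.sum_le_sum fun c hc => five_le_card_cross (hS hc)
  rw [h3]
  have h5 : ∑ c ∈ S, (outside N c : ℤ) = ((∑ c ∈ S, outside N c : ℕ) : ℤ) := by push_cast; rfl
  rw [h5]
  omega

theorem card_filter_le_sum {S : Finset (ℤ × ℤ)} {P : ℤ × ℤ → Prop} [DecidablePred P] {n : ℕ}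
    (f : ℕ → ℤ × ℤ) (h : ∀ c ∈ S, P c → ∃ k < n, f k = c) :
    ((S.filter P).card : ℤ) ≤ ∑ k ∈ Finset.range n, indicator (fun c => decide (c ∈ S)) (f k) := by
  have h1 : S.filter P ⊆ ((Finset.range n).filter fun k => f k ∈ S).image f := by
    intro c hc
    rw [Finset.mem_filter] at hc
    obtain ⟨k, hk, rfl⟩ := h c hc.1 hc.2
    exact Finset.mem_image_of_mem _ (by simpa using ⟨hk, hc.1⟩)
  have h2 := (Finset.card_le_card h1).trans Finset.card_image_le
  rw [Finset.card_filter (fun k => f k ∈ S)] at h2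
  zify at h2
  simpa [indicator] using h2

theorem five_mul_card_le_of_large {m : ℕ} {S : Finset (ℤ × ℤ)} (hS : S ⊆ triangle (m + 16))
    (hp : CrossPacking fun c => decide (c ∈ S)) :
    5 * S.card ≤ (triangle (m + 16)).card + 11 := by
  have h := five_mul_card_le hS hp
  have hb := sum_boundary_le hp (m := m) fun c hc => hS (by simpa using hc)
  have hT : ∀ c ∈ S, 1 ≤ c.1 ∧ c.1 < c.2 ∧ c.2 ≤ (m : ℤ) + 16 := fun c hc => by
    have := mem_triangle.mp (hS hc)
    push_cast at this
    exact this
  have b1 := card_filter_le_sum (S := S) (P := fun c => c.1 = 1) (n := m + 15)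
    (fun k => (1, (k : ℤ) + 2)) fun c hc h1 => by
      have := hT c hc
      refine ⟨(c.2 - 2).toNat, by omega, ?_⟩
      ext <;> dsimp only <;> omega
  have b2 := card_filter_le_sum (S := S) (P := fun c => c.2 = ((m + 16 : ℕ) : ℤ)) (n := m + 15)
    (fun k => ((k : ℤ) + 1, (m : ℤ) + 16)) fun c hc h1 => by
      have := hT c hc
      push_cast at h1
      refine ⟨(c.1 - 1).toNat, by omega, ?_⟩
      ext <;> dsimp only <;> omega
  have b3 := card_filter_le_sum (S := S) (P := fun c => c.2 = c.1 + 1) (n := m + 15)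
    (fun k => ((k : ℤ) + 1, (k : ℤ) + 2)) fun c hc h1 => by
      have := hT c hc
      refine ⟨(c.1 - 1).toNat, by omega, ?_⟩
      ext <;> dsimp only <;> omega
  rw [← Finset.mul_sum] at hb
  have ho : ∑ c ∈ S, (outside (m + 16) c : ℤ) = ((S.filter fun c => c.1 = 1).card : ℤ) +
      ((S.filter fun c => c.2 = ((m + 16 : ℕ) : ℤ)).card : ℤ) +
      2 * ((S.filter fun c => c.2 = c.1 + 1).card : ℤ) := by
    simp only [outside, Finset.card_filter, Nat.cast_add, Nat.cast_sum, Finset.sum_add_distrib,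
      Finset.mul_sum]
    congr 1
    refine Finset.sum_congr rfl fun c _ => ?_
    split_ifs <;> simp
  omega

/-! ### Small triangles and the upper bound in general. -/

/-- The antidiagonal order of the cells of the triangle. -/
def triangleKeys (N : ℕ) : List ℤ :=
  (List.range (2 * N)).flatMap fun s =>
    ((List.range N).filter fun i => decide (0 < i ∧ 2 * i < s ∧ s ≤ N + i)).map fun i : ℕ =>
      32 * (s : ℤ) + i

/-- The sweep over the triangle of side `N` that counts the chosen cells finds at most `K`. -/
def triangleCheck (N : ℕ) (K : ℤ) : Bool :=
  decide (triangleKeys N).Nodup &&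
    ((boxCells N N fun c => decide (c.1 < c.2)).map fun c => (c, (1 : ℤ))).all
      (fun g => decide (32 * (g.1.1 + g.1.2) + g.1.1 ∈ triangleKeys N)) &&
    ([] : List (ℤ × ℤ)).all (fun _ => decide (0 ∈ triangleKeys N)) &&
    (run (fun _ => true) (sweep (fun c => 32 * (c.1 + c.2) + c.1) (fun _ => 0)
      (fun s c => decide (s ≤ 32 * (c.1 + c.2) + c.1 + 65)) (triangleKeys N)
      (boxCells N N fun c => decide (c.1 < c.2)) []
      ((boxCells N N fun c => decide (c.1 < c.2)).map fun c => (c, 1)) [])).2.boundedBy K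

/-- `triangleCheck` unfolds to the hypothesis of `gainSum_le` with weight 1 on each cell and neither
gaps nor potential. -/
theorem card_le_of_triangleCheck {N : ℕ} {K : ℤ} (hK : triangleCheck N K = true)
    {S : Finset (ℤ × ℤ)} (hS : S ⊆ triangle N) (hp : CrossPacking fun c => decide (c ∈ S)) :
    (S.card : ℤ) ≤ K := by
  have h := gainSum_le (dom := fun _ => true) (key := fun c => 32 * (c.1 + c.2) + c.1)
    -- The last cell within distance 2 of `(x, y)` in this order is `(x + 2, y)`, whose key is
    -- larger by 2 * 32 + 2 = 66; from then on `(x, y)` can be forgotten.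
    (late := fun _ => 0) (active := fun s c => decide (s ≤ 32 * (c.1 + c.2) + c.1 + 65))
    (L := triangleKeys N) (centres := boxCells N N fun c => decide (c.1 < c.2)) (gaps := [])
    (gains := (boxCells N N fun c => decide (c.1 < c.2)).map fun c => (c, 1)) (bdry := [])
    hp (fun _ _ => rfl) hK
  refine le_trans ?_ h
  have h1 : S ⊆ (boxCells N N fun c => decide (c.1 < c.2)).toFinset := by
    intro c hc
    have := mem_triangle.mp (hS hc)
    simp only [List.mem_toFinset, boxCells, List.mem_filter, List.mem_flatMap, List.mem_range,
      List.mem_map, decide_eq_true_eq]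
    refine ⟨⟨(c.1 - 1).toNat, by omega, (c.2 - 1).toNat, by omega, ?_⟩, this.2.1⟩
    ext <;> dsimp only <;> omega
  have h2 : ∀ l : List (ℤ × ℤ), ((l.toFinset.filter fun c => c ∈ S).card : ℤ) ≤
      gainSum (fun c => decide (c ∈ S)) (l.map fun c => (c, 1)) := by
    intro l
    induction l with
    | nil => simp [gainSum]
    | cons a l ih =>
      rw [List.toFinset_cons, Finset.filter_insert]
      simp only [gainSum, List.map_cons, List.sum_cons, decide_eq_true_eq] at ih ⊢
      have := Finset.card_insert_le a (l.toFinset.filter fun c => c ∈ S)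
      split_ifs <;> omega
  have h3 := h2 (boxCells N N fun c => decide (c.1 < c.2))
  rw [Finset.filter_mem_eq_inter, Finset.inter_eq_right.mpr h1] at h3
  simpa [gapCount, polyValue] using h3

/-- The largest size of a packing of crosses with centres in the triangle of side `n + 2`. -/
def packingNumber (n : ℕ) : ℕ :=
  if n < 5 then max 1 n else ((n + 2) * (n + 1) + 20) / 10

/-- Sides 2 to 15, which the boundary argument does not reach. For `n < 5` the value is one less
than the quadratic formula gives. -/
theorem triangleCheck_packingNumber :
    ∀ n ∈ List.range 14, triangleCheck (n + 2) (packingNumber n : ℕ) = true := by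
  decide +kernel

theorem card_le_packingNumber {n : ℕ} {S : Finset (ℤ × ℤ)} (hS : S ⊆ triangle (n + 2))
    (hp : CrossPacking fun c => decide (c ∈ S)) : S.card ≤ packingNumber n := by
  rcases lt_or_ge n 14 with hn | hn
  · zify
    exact card_le_of_triangleCheck (triangleCheck_packingNumber n (by simpa using hn)) hS hp
  · obtain ⟨m, rfl⟩ := Nat.exists_eq_add_of_le' hn
    have h1 := five_mul_card_le_of_large hS hp
    have h2 := two_mul_card_triangle (m + 14 + 2)
    rw [packingNumber, if_neg (by omega)]
    have h3 : (m + 14 + 2) * (m + 14 + 2 - 1) = (m + 14 + 2) * (m + 14 + 1) := rfl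
    rw [h3] at h2
    have h4 : (m + 14 + 2) * (m + 14 + 1) % 10 = (m % 10 + 16) * (m % 10 + 15) % 10 := by
      rw [Nat.mul_mod]
      conv_rhs => rw [Nat.mul_mod]
      congr 2 <;> omega
    have h5 : m % 10 < 10 := Nat.mod_lt _ (by norm_num)
    -- The counting bound is `(q + 22) / 10` with `q = N(N - 1)`. It agrees with `(q + 20) / 10`
    -- because `q` is never 8 or 9 modulo 10.
    have h6 : (m + 14 + 2) * (m + 14 + 1) % 10 = 0 ∨ (m + 14 + 2) * (m + 14 + 1) % 10 = 2 ∨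
        (m + 14 + 2) * (m + 14 + 1) % 10 = 6 := by
      rw [h4]
      generalize m % 10 = r at h5
      interval_cases r <;> simp
    rw [Nat.le_div_iff_mul_le (by norm_num)]
    change 5 * S.card ≤ (triangle (m + 14 + 2)).card + 11 at h1
    clear h4 h3 hn
    generalize (m + 14 + 2) * (m + 14 + 1) = q at h2 h6 ⊢
    omega

/-! ### Lower bound from the perfect Lee code. -/

/-- The cells of the triangle of side `N` in a class of the perfect Lee code. -/
noncomputable def latticeCells (N : ℕ) (r : ℤ) : Finset (ℤ × ℤ) :=
  (triangle N).filter fun p => (p.1 + 2 * p.2) % 5 = r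

theorem mem_latticeCells {N : ℕ} {r : ℤ} {p : ℤ × ℤ} :
    p ∈ latticeCells N r ↔ (1 ≤ p.1 ∧ p.1 < p.2 ∧ p.2 ≤ N) ∧ (p.1 + 2 * p.2) % 5 = r := by
  rw [latticeCells, Finset.mem_filter, mem_triangle]

/-- Each of the rows `1, …, N` meets the class exactly once in the five new columns, and `p`, `q`
lie in the new small triangle at the far acute corner. -/
theorem card_latticeCells_add_five {N : ℕ} {r : ℤ} {p q : ℤ × ℤ} (hpq : p ≠ q)
    (hp : p ∈ latticeCells (N + 5) r) (hq : q ∈ latticeCells (N + 5) r) (hp1 : (N : ℤ) < p.1)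
    (hq1 : (N : ℤ) < q.1) (hr0 : 0 ≤ r) (hr5 : r < 5) :
    (latticeCells N r).card + (N + 2) ≤ (latticeCells (N + 5) r).card := by
  -- As 3 is the inverse of 2 modulo 5, the column must be congruent to `3 * (r - x)` in row `x = k
  -- + 1`; this is its representative in `N + 1, …, N + 5`.
  set f : ℕ → ℤ × ℤ := fun k =>
    ((k : ℤ) + 1, (N : ℤ) + 1 + (3 * (r - (k + 1)) - (N + 1)) % 5)
  have hf : Function.Injective f := fun a b hab => by
    have := congrArg Prod.fst hab
    simpa [f] using this
  have hd1 : Disjoint (latticeCells N r) ((Finset.range N).image f) := by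
    rw [Finset.disjoint_left]
    intro x hx hx'
    obtain ⟨k, -, rfl⟩ := Finset.mem_image.mp hx'
    rw [mem_latticeCells] at hx
    simp only [f] at hx
    omega
  have hd2 : Disjoint (latticeCells N r ∪ (Finset.range N).image f) {p, q} := by
    rw [Finset.disjoint_left]
    intro x hx hx'
    have hx1 : x.1 ≤ N := by
      rcases Finset.mem_union.mp hx with h | h
      · rw [mem_latticeCells] at h
        omega
      · obtain ⟨k, hk, rfl⟩ := Finset.mem_image.mp h
        rw [Finset.mem_range] at hk
        simp only [f]
        omega
    rcases Finset.mem_insert.mp hx' with rfl | h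
    · omega
    · rw [Finset.mem_singleton] at h
      subst h
      omega
  have hsub : latticeCells N r ∪ (Finset.range N).image f ∪ {p, q} ⊆ latticeCells (N + 5) r := by
    intro x hx
    rcases Finset.mem_union.mp hx with hx | hx
    · rcases Finset.mem_union.mp hx with h | h
      · rw [mem_latticeCells] at h ⊢
        push_cast
        omega
      · obtain ⟨k, hk, rfl⟩ := Finset.mem_image.mp h
        rw [Finset.mem_range] at hk
        rw [mem_latticeCells]
        simp only [f]
        push_cast
        omega
    · rcases Finset.mem_insert.mp hx with rfl | h
      · exact hp
      · rwa [Finset.mem_singleton.mp h]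
  have h := Finset.card_le_card hsub
  rw [Finset.card_union_of_disjoint hd2, Finset.card_union_of_disjoint hd1,
    Finset.card_image_of_injective _ hf, Finset.card_range, Finset.card_pair hpq] at h
  omega

/-- The excess `κ` over the quadratic persists, since `(N + 5)(N + 4) - N(N - 1) = 10(N + 2)`.
Translating `p` and `q` by `(N, N)` adds `3 * N ≡ 3 * s` to the form `x + 2y`. -/
theorem mul_sub_one_le_card_latticeCells {s : ℕ} {r κ : ℤ} {p q : ℤ × ℤ} (hpq : p ≠ q)
    (hp : 1 ≤ p.1 ∧ p.1 < p.2 ∧ p.2 ≤ 5 ∧ (3 * s + p.1 + 2 * p.2) % 5 = r)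
    (hq : 1 ≤ q.1 ∧ q.1 < q.2 ∧ q.2 ≤ 5 ∧ (3 * s + q.1 + 2 * q.2) % 5 = r)
    (h0 : (s : ℤ) * (s - 1) + κ ≤ 10 * (latticeCells s r).card) (k : ℕ) :
    (5 * k + s : ℤ) * (5 * k + s - 1) + κ ≤ 10 * (latticeCells (5 * k + s) r).card := by
  induction k with
  | zero => simpa using h0
  | succ k ih =>
    have h := card_latticeCells_add_five (N := 5 * k + s) (r := r)
      (p := (p.1 + (5 * k + s : ℕ), p.2 + (5 * k + s : ℕ)))
      (q := (q.1 + (5 * k + s : ℕ), q.2 + (5 * k + s : ℕ)))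
      (fun h => hpq (by simpa [Prod.ext_iff] using h))
      (by rw [mem_latticeCells]; push_cast; omega) (by rw [mem_latticeCells]; push_cast; omega)
      (by push_cast; omega) (by push_cast; omega) (by omega) (by omega)
    rw [show 5 * (k + 1) + s = 5 * k + s + 5 by ring]
    zify at h
    push_cast at h ⊢
    linarith

/-- The steps of length at most two. -/
def diamond : List (ℤ × ℤ) :=
  [(-2, 0), (-1, -1), (-1, 0), (-1, 1), (0, -2), (0, -1), (0, 0), (0, 1), (0, 2), (1, -1), (1, 0),
    (1, 1), (2, 0)]

theorem mem_diamond {d : ℤ × ℤ} (h : d.1.natAbs + d.2.natAbs ≤ 2) : d ∈ diamond := by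
  obtain ⟨a, b⟩ := d
  dsimp only at h
  obtain ⟨h1, h2, h3, h4⟩ : -2 ≤ a ∧ a ≤ 2 ∧ -2 ≤ b ∧ b ≤ 2 := by omega
  interval_cases a <;> interval_cases b <;> first | decide | omega

/-- Exchanging the cells `D` of a class of the perfect code for the cells `E`. -/
theorem exists_packing_of_exchange {N : ℕ} {r : ℤ} (D E : List (ℤ × ℤ))
    (hE : ∀ p ∈ E, p ∈ triangle N)
    (hEr : ∀ p ∈ E, (p.1 + 2 * p.2) % 5 ≠ r)
    (hEE : E.Pairwise fun p q => 3 ≤ (p.1 - q.1).natAbs + (p.2 - q.2).natAbs)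
    (hED : ∀ p ∈ E, ∀ d ∈ diamond, (p.1 + d.1, p.2 + d.2) ∈ latticeCells N r →
      (p.1 + d.1, p.2 + d.2) ∈ D) :
    ∃ S ⊆ triangle N, CrossPacking (fun c => decide (c ∈ S)) ∧
      (latticeCells N r).card + E.length ≤ S.card + D.length := by
  have hED' : ∀ p ∈ E, ∀ q ∈ latticeCells N r,
      (p.1 - q.1).natAbs + (p.2 - q.2).natAbs ≤ 2 → q ∈ D := fun p hp q hq hpq => by
    have h := hED p hp (q.1 - p.1, q.2 - p.2) (mem_diamond (by dsimp only; omega))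
    simp only [add_sub_cancel] at h
    exact h hq
  refine ⟨(latticeCells N r \ D.toFinset) ∪ E.toFinset, ?_, ?_, ?_⟩
  · refine Finset.union_subset (Finset.sdiff_subset.trans (Finset.filter_subset _ _)) fun p hp => ?_
    exact hE p (by simpa using hp)
  · intro p q hp hq hpq
    simp only [decide_eq_true_eq, Finset.mem_union, Finset.mem_sdiff, List.mem_toFinset] at hp hq
    rw [closeCells, decide_eq_true_eq] at hpq
    rcases hp with hp | hp <;> rcases hq with hq | hq
    · have h1 := (mem_latticeCells.mp hp.1).2
      have h2 := (mem_latticeCells.mp hq.1).2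
      have hx : p.1 - q.1 = -2 ∨ p.1 - q.1 = -1 ∨ p.1 - q.1 = 0 ∨ p.1 - q.1 = 1 ∨
          p.1 - q.1 = 2 := by omega
      have hy : p.2 - q.2 = -2 ∨ p.2 - q.2 = -1 ∨ p.2 - q.2 = 0 ∨ p.2 - q.2 = 1 ∨
          p.2 - q.2 = 2 := by omega
      have h0 : p.1 - q.1 = 0 ∧ p.2 - q.2 = 0 := by
        rcases hx with hx | hx | hx | hx | hx <;> rcases hy with hy | hy | hy | hy | hy <;> omega
      ext <;> omega
    · exact absurd (hED' q hq p hp.1 (by omega)) hp.2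
    · exact absurd (hED' p hp q hq.1 hpq) hq.2
    · by_contra hne
      have : Std.Symm fun p q : ℤ × ℤ => 3 ≤ (p.1 - q.1).natAbs + (p.2 - q.2).natAbs :=
        ⟨fun p q h => by omega⟩
      have := hEE.forall hp hq hne
      omega
  · have hd : Disjoint (latticeCells N r \ D.toFinset) E.toFinset := by
      rw [Finset.disjoint_left]
      intro p hp hpE
      exact hEr p (by simpa using hpE) (mem_latticeCells.mp (Finset.mem_sdiff.mp hp).1).2
    have hE' : E.toFinset.card = E.length := by
      refine List.toFinset_card_of_nodup (hEE.imp fun h => ?_)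
      rintro rfl
      simp at h
    have h1 := Finset.le_card_sdiff D.toFinset (latticeCells N r)
    have h2 := D.toFinset_card_le
    rw [Finset.card_union_of_disjoint hd, hE']
    omega

theorem exists_packing_of_list {N : ℕ} (E : List (ℤ × ℤ))
    (hE : E.all (fun p => decide (1 ≤ p.1 ∧ p.1 < p.2 ∧ p.2 ≤ N)) = true)
    (hEE : E.Pairwise fun p q => 3 ≤ (p.1 - q.1).natAbs + (p.2 - q.2).natAbs) :
    ∃ S ⊆ triangle N, CrossPacking (fun c => decide (c ∈ S)) ∧ E.length ≤ S.card := by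
  -- No residue modulo 5 equals 5, so the class is empty and the packing consists of `E` alone.
  obtain ⟨S, h1, h2, h3⟩ := exists_packing_of_exchange (N := N) (r := 5) [] E
    (fun p hp => mem_triangle.mpr (by simpa using List.all_eq_true.mp hE p hp))
    (fun p _ => by omega) hEE fun p _ d _ hq => by
      have := mem_latticeCells.mp hq
      omega
  exact ⟨S, h1, h2, by simp at h3; omega⟩

theorem exists_packing (n : ℕ) : ∃ S ⊆ triangle (n + 2), CrossPacking (fun c => decide (c ∈ S)) ∧
    packingNumber n ≤ S.card := by
  rcases lt_or_ge n 5 with hn | hn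
  · interval_cases n
    · exact exists_packing_of_list [(1, 2)] (by decide) (by decide)
    · exact exists_packing_of_list [(1, 2)] (by decide) (by decide)
    · exact exists_packing_of_list [(1, 2), (3, 4)] (by decide) (by decide)
    · exact exists_packing_of_list [(1, 2), (1, 5), (3, 4)] (by decide) (by decide)
    · exact exists_packing_of_list [(1, 2), (1, 5), (3, 4), (5, 6)] (by decide) (by decide)
  rw [packingNumber, if_neg (by omega)]
  obtain ⟨k, s, hs, hN⟩ : ∃ k s : ℕ, s < 5 ∧ n + 2 = 5 * k + s :=
    ⟨(n + 2) / 5, (n + 2) % 5, by omega, by omega⟩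
  have hN1 : n + 1 = 5 * k + s - 1 := by omega
  rw [hN1, hN]
  have hk : (1 : ℤ) ≤ k := by omega
  have key : ∀ (r κ : ℤ) (p q : ℤ × ℤ) (D E : List (ℤ × ℤ)), p ≠ q →
      (1 ≤ p.1 ∧ p.1 < p.2 ∧ p.2 ≤ 5 ∧ (3 * s + p.1 + 2 * p.2) % 5 = r) →
      (1 ≤ q.1 ∧ q.1 < q.2 ∧ q.2 ≤ 5 ∧ (3 * s + q.1 + 2 * q.2) % 5 = r) →
      (s : ℤ) * (s - 1) + κ ≤ 10 * (latticeCells s r).card →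
      -- The 9 is the slack of the rounded division by 10.
      10 * (D.length : ℤ) + 20 ≤ κ + 10 * E.length + 9 →
      (∀ p ∈ E, p ∈ triangle (5 * k + s)) →
      (∀ p ∈ E, (p.1 + 2 * p.2) % 5 ≠ r) →
      (E.Pairwise fun p q => 3 ≤ (p.1 - q.1).natAbs + (p.2 - q.2).natAbs) →
      (∀ p ∈ E, ∀ d ∈ diamond, (p.1 + d.1, p.2 + d.2) ∈ latticeCells (5 * k + s) r →
        (p.1 + d.1, p.2 + d.2) ∈ D) →
      ∃ S ⊆ triangle (5 * k + s), CrossPacking (fun c => decide (c ∈ S)) ∧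
        ((5 * k + s) * (5 * k + s - 1) + 20) / 10 ≤ S.card := by
    intro r κ p q D E hpq hp hq h0 hκ h2 h3 h4 h5
    obtain ⟨S, hST, hS, hcard⟩ := exists_packing_of_exchange D E h2 h3 h4 h5
    refine ⟨S, hST, hS, ?_⟩
    have h := mul_sub_one_le_card_latticeCells hpq hp hq h0 k
    have hc : (((5 * k + s) * (5 * k + s - 1) : ℕ) : ℤ) = (5 * k + s : ℤ) * (5 * k + s - 1) := by
      rw [Nat.cast_mul, Nat.cast_sub (by omega)]
      push_cast
      ring
    rw [← hc] at h
    generalize (5 * k + s) * (5 * k + s - 1) = Q at h ⊢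
    omega
  have one_le : ∀ s : ℕ, 3 ≤ s → 1 ≤ (latticeCells s 2).card := fun s hs =>
    Finset.card_pos.mpr ⟨(1, 3), by rw [mem_latticeCells]; dsimp only; omega⟩
  -- In each residue class the exchanges take place near the acute corners `(1, 2)` and `(N - 1,
  -- N)`. The net gain is two cells, except for `s = 3`, where the excess `κ = 4` makes one enough.
  interval_cases s
  · refine key 1 (0) (1, 5) (3, 4) [(5 * k - 5, 5 * k - 2), (5 * k - 4, 5 * k), (5 * k - 2, 5 * k - 1)]
      [(1, 2), (5 * k - 5, 5 * k), (5 * k - 4, 5 * k - 3), (5 * k - 3, 5 * k - 1), (5 * k - 1, 5 * k)]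
      (by decide) (by decide) (by decide) (by simp) (by simp) ?_ ?_ ?_ ?_
    all_goals simp only [List.forall_mem_cons, List.not_mem_nil, false_imp_iff, implies_true,
      and_true, mem_latticeCells, mem_triangle, List.pairwise_cons, List.Pairwise.nil, diamond,
      Nat.cast_add, Nat.cast_mul, Nat.cast_ofNat]
    all_goals repeat' apply And.intro
    all_goals
      first
      | omega
      | (simp only [List.mem_cons, Prod.mk.injEq, List.not_mem_nil, or_false]; omega)
  · refine key 4 (0) (1, 5) (3, 4) [(1, 4), (2, 6), (5 * k - 4, 5 * k - 1), (5 * k - 3, 5 * k + 1), (5 * k - 1, 5 * k)]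
      [(1, 2), (1, 6), (2, 4), (5 * k - 4, 5 * k + 1), (5 * k - 3, 5 * k - 2), (5 * k - 2, 5 * k), (5 * k, 5 * k + 1)]
      (by decide) (by decide) (by decide) (by simp) (by simp) ?_ ?_ ?_ ?_
    all_goals simp only [List.forall_mem_cons, List.not_mem_nil, false_imp_iff, implies_true,
      and_true, mem_latticeCells, mem_triangle, List.pairwise_cons, List.Pairwise.nil, diamond,
      Nat.cast_add, Nat.cast_mul, Nat.cast_ofNat]
    all_goals repeat' apply And.intro
    all_goals
      first
      | omega
      | (simp only [List.mem_cons, Prod.mk.injEq, List.not_mem_nil, or_false, and_true]; omega)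
  · refine key 1 (-2) (1, 2) (2, 4) []
      [(1, 2), (5 * k + 1, 5 * k + 2)]
      (by decide) (by decide) (by decide) (by simp) (by simp) ?_ ?_ ?_ ?_
    all_goals simp only [List.forall_mem_cons, List.not_mem_nil, false_imp_iff, implies_true,
      and_true, mem_latticeCells, mem_triangle, List.pairwise_cons, List.Pairwise.nil, diamond,
      Nat.cast_add, Nat.cast_mul, Nat.cast_ofNat]
    all_goals repeat' apply And.intro
    all_goals omega
  · refine key 2 (4) (2, 3) (3, 5) [(1, 3), (2, 5)]
      [(1, 2), (1, 5), (3, 4)]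
      (by decide) (by decide) (by decide) (by have := one_le 3 (by norm_num); omega) (by simp) ?_ ?_ ?_ ?_
    all_goals simp only [List.forall_mem_cons, List.not_mem_nil, false_imp_iff, implies_true,
      and_true, mem_latticeCells, mem_triangle, List.pairwise_cons, List.Pairwise.nil, diamond,
      Nat.cast_add, Nat.cast_mul, Nat.cast_ofNat]
    all_goals repeat' apply And.intro
    all_goals
      first
      | omega
      | (simp only [List.mem_cons, Prod.mk.injEq, List.not_mem_nil, or_false]; omega)
  · refine key 2 (-2) (1, 2) (2, 4) [(1, 3), (2, 5)]
      [(1, 2), (1, 5), (3, 4), (5 * k + 3, 5 * k + 4)]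
      (by decide) (by decide) (by decide) (by have := one_le 4 (by norm_num); omega) (by simp) ?_ ?_ ?_ ?_
    all_goals simp only [List.forall_mem_cons, List.not_mem_nil, false_imp_iff, implies_true,
      and_true, mem_latticeCells, mem_triangle, List.pairwise_cons, List.Pairwise.nil, diamond,
      Nat.cast_add, Nat.cast_mul, Nat.cast_ofNat]
    all_goals repeat' apply And.intro
    all_goals
      first
      | omega
      | (simp only [List.mem_cons, Prod.mk.injEq, List.not_mem_nil, or_false]; omega)

/-! ### Dictionary between words of weight two and cells. -/

/-- The word of length `n` whose ones are at the two positions given by a cell. -/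
def pairWord (n : ℕ) (c : ℤ × ℤ) : Fin n → ZMod 2 :=
  fun k => if (k : ℤ) + 1 = c.1 ∨ (k : ℤ) + 1 = c.2 then 1 else 0

theorem pairWord_eq_one {n : ℕ} {c : ℤ × ℤ} {k : Fin n} :
    pairWord n c k = 1 ↔ (k : ℤ) + 1 = c.1 ∨ (k : ℤ) + 1 = c.2 := by
  rw [pairWord]
  split_ifs with h <;> simp [h]

theorem pairWord_injOn (n : ℕ) : Set.InjOn (pairWord n) (triangle n) := by
  intro c hc d hd h
  rw [Finset.mem_coe, mem_triangle] at hc hd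
  have h1 : ∀ k : Fin n, ((k : ℤ) + 1 = c.1 ∨ (k : ℤ) + 1 = c.2) ↔
      ((k : ℤ) + 1 = d.1 ∨ (k : ℤ) + 1 = d.2) := fun k => by
    rw [← pairWord_eq_one, ← pairWord_eq_one, h]
  have a1 := h1 ⟨(c.1 - 1).toNat, by omega⟩
  have a2 := h1 ⟨(c.2 - 1).toNat, by omega⟩
  have a3 := h1 ⟨(d.1 - 1).toNat, by omega⟩
  dsimp only at a1 a2 a3
  ext <;> omega

theorem hammingNorm_pairWord {n : ℕ} {c : ℤ × ℤ} (hc : c ∈ triangle n) :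
    hammingNorm (pairWord n c) = 2 := by
  rw [mem_triangle] at hc
  rw [hammingNorm, Finset.card_eq_two]
  refine ⟨⟨(c.1 - 1).toNat, by omega⟩, ⟨(c.2 - 1).toNat, by omega⟩, ?_, ?_⟩
  · rw [Ne, Fin.mk.injEq]
    omega
  · ext k
    have hk : ∀ a : ZMod 2, a ≠ 0 ↔ a = 1 := by decide
    rw [Finset.mem_filter_univ, hk, pairWord_eq_one]
    simp only [Finset.mem_insert, Finset.mem_singleton, Fin.ext_iff]
    omega

theorem exists_pairWord_eq {n : ℕ} {u : Fin n → ZMod 2} (hu : hammingNorm u = 2) :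
    ∃ c ∈ triangle n, pairWord n c = u := by
  rw [hammingNorm, Finset.card_eq_two] at hu
  obtain ⟨x, y, hxy, h⟩ := hu
  wlog hlt : x < y generalizing x y
  · exact this y x hxy.symm (by rw [h, Finset.pair_comm]) (by omega)
  refine ⟨((x : ℤ) + 1, (y : ℤ) + 1), ?_, ?_⟩
  · rw [mem_triangle]
    dsimp only
    omega
  · funext k
    have hk : u k ≠ 0 ↔ k = x ∨ k = y := by
      have := Finset.ext_iff.mp h k
      simpa using this
    rw [pairWord]
    split_ifs with h1
    · have h2 : k = x ∨ k = y := by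
        simp only [Fin.ext_iff]
        omega
      have h3 := hk.mpr h2
      have h4 : ∀ a : ZMod 2, a ≠ 0 → 1 = a := by decide
      exact h4 _ h3
    · have h2 : ¬ (k = x ∨ k = y) := by
        simp only [Fin.ext_iff]
        omega
      by_contra h3
      exact h2 (hk.mp (Ne.symm h3))

theorem pairWord_comp_swap {n : ℕ} {i j : Fin n} (hij : (j : ℕ) = i + 1) {c d : ℤ × ℤ}
    (h1 : ((i : ℤ) + 1 = d.1 ∨ (i : ℤ) + 1 = d.2) ↔ ((i : ℤ) + 2 = c.1 ∨ (i : ℤ) + 2 = c.2))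
    (h2 : ((i : ℤ) + 2 = d.1 ∨ (i : ℤ) + 2 = d.2) ↔ ((i : ℤ) + 1 = c.1 ∨ (i : ℤ) + 1 = c.2))
    (h3 : ∀ x : ℤ, x ≠ i + 1 → x ≠ i + 2 → ((x = d.1 ∨ x = d.2) ↔ (x = c.1 ∨ x = c.2))) :
    pairWord n d = pairWord n c ∘ Equiv.swap i j := by
  have hj : (j : ℤ) = i + 1 := by exact_mod_cast hij
  funext k
  simp only [Function.comp, pairWord, Equiv.swap_apply_def]
  refine if_congr ?_ rfl rfl
  split_ifs with hk1 hk2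
  · rw [hk1, hj, h1, add_assoc]
    norm_num
  · rw [hk2, hj, add_assoc, ← h2]
    norm_num
  · refine h3 _ ?_ ?_ <;> · rw [Fin.ext_iff] at hk1 hk2; omega

theorem mem_transpositionBall_pairWord {n : ℕ} {c : ℤ × ℤ} (hc : c ∈ triangle n)
    {v : Fin n → ZMod 2} : v ∈ transpositionBall (pairWord n c) ↔
      ∃ d ∈ triangle n, (c.1 - d.1).natAbs + (c.2 - d.2).natAbs ≤ 1 ∧ v = pairWord n d := by
  have hc' := mem_triangle.mp hc
  constructor
  · rintro (rfl | ⟨i, j, hij, rfl⟩)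
    · exact ⟨c, hc, by simp, rfl⟩
    · have hjn := j.isLt
      -- Exchanging the two ones with each other fixes the word; moving both coordinates instead
      -- would leave the triangle.
      by_cases hb : (i : ℤ) + 1 = c.1 ∧ (i : ℤ) + 2 = c.2
      · exact ⟨c, hc, by simp, (pairWord_comp_swap hij (by omega) (by omega) (by omega)).symm⟩
      refine ⟨(if c.1 = i + 1 then (i : ℤ) + 2 else if c.1 = i + 2 then (i : ℤ) + 1 else c.1,
        if c.2 = i + 1 then (i : ℤ) + 2 else if c.2 = i + 2 then (i : ℤ) + 1 else c.2), ?_, ?_,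
        (pairWord_comp_swap hij ?_ ?_ ?_).symm⟩
      · rw [mem_triangle]
        dsimp only
        split_ifs <;> omega
      · dsimp only
        split_ifs <;> omega
      · dsimp only
        split_ifs <;> omega
      · dsimp only
        split_ifs <;> omega
      · intro x hx1 hx2
        dsimp only
        split_ifs <;> omega
  · rintro ⟨d, hd, hcd, rfl⟩
    have hd' := mem_triangle.mp hd
    rcases (by omega : c.1 = d.1 ∧ c.2 = d.2 ∨ (c.1 = d.1 + 1 ∨ d.1 = c.1 + 1) ∧ c.2 = d.2 ∨
      c.1 = d.1 ∧ (c.2 = d.2 + 1 ∨ d.2 = c.2 + 1)) with h | h | h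
    · exact Or.inl (by rw [Prod.ext h.1 h.2])
    · refine Or.inr ⟨⟨(min c.1 d.1 - 1).toNat, by omega⟩, ⟨(min c.1 d.1).toNat, by omega⟩,
        by dsimp only; omega, ?_⟩
      refine pairWord_comp_swap (by dsimp only; omega) ?_ ?_ ?_ <;> dsimp only <;> omega
    · refine Or.inr ⟨⟨(min c.2 d.2 - 1).toNat, by omega⟩, ⟨(min c.2 d.2).toNat, by omega⟩,
        by dsimp only; omega, ?_⟩
      refine pairWord_comp_swap (by dsimp only; omega) ?_ ?_ ?_ <;> dsimp only <;> omega

theorem disjoint_transpositionBall_iff {n : ℕ} {c d : ℤ × ℤ} (hc : c ∈ triangle n)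
    (hd : d ∈ triangle n) :
    Disjoint (transpositionBall (pairWord n c)) (transpositionBall (pairWord n d)) ↔
      3 ≤ (c.1 - d.1).natAbs + (c.2 - d.2).natAbs := by
  rw [Set.disjoint_left]
  constructor
  · intro h
    by_contra hlt
    have hc' := mem_triangle.mp hc
    have hd' := mem_triangle.mp hd
    obtain ⟨e, he, h1, h2⟩ : ∃ e ∈ triangle n, (c.1 - e.1).natAbs + (c.2 - e.2).natAbs ≤ 1 ∧
        (d.1 - e.1).natAbs + (d.2 - e.2).natAbs ≤ 1 := by
      simp only [mem_triangle]
      rcases (by omega : (c.1 - d.1).natAbs + (c.2 - d.2).natAbs ≤ 1 ∨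
        (c.1 = d.1 ∧ c.2 ≠ d.2) ∨ (c.1 ≠ d.1 ∧ c.2 = d.2) ∨
        ((c.1 - d.1).natAbs = 1 ∧ (c.2 - d.2).natAbs = 1)) with h | h | h | h
      · exact ⟨c, hc', by omega, by omega⟩
      · exact ⟨(c.1, min c.2 d.2 + 1), by dsimp only; omega, by dsimp only; omega,
          by dsimp only; omega⟩
      · exact ⟨(min c.1 d.1 + 1, c.2), by dsimp only; omega, by dsimp only; omega,
          by dsimp only; omega⟩
      -- Diagonal neighbours have two common neighbours; the one chosen lies in the triangle even
      -- next to the diagonal edge.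
      · by_cases h1 : c.1 < d.1 ↔ c.2 < d.2
        · exact ⟨(min c.1 d.1, max c.2 d.2), by dsimp only; omega, by dsimp only; omega,
            by dsimp only; omega⟩
        · exact ⟨(d.1, c.2), by dsimp only; omega, by dsimp only; omega, by dsimp only; omega⟩
    exact h ((mem_transpositionBall_pairWord hc).mpr ⟨e, he, h1, rfl⟩)
      ((mem_transpositionBall_pairWord hd).mpr ⟨e, he, h2, rfl⟩)
  · intro h v hv hv'
    obtain ⟨e, he, h1, rfl⟩ := (mem_transpositionBall_pairWord hc).mp hv
    obtain ⟨f, hf, h2, hef⟩ := (mem_transpositionBall_pairWord hd).mp hv'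
    obtain rfl := pairWord_injOn n he hf hef
    omega

theorem A085680_eq (n : ℕ) : A085680 (n + 2) = packingNumber n := by
  obtain ⟨⟨C, hC, hcard⟩, hmax⟩ := maxTranspositionCode_isGreatest (n + 2) 2
  refine le_antisymm ?_ ?_
  · classical
    rw [A085680, ← hcard]
    set S := (triangle (n + 2)).filter fun c => pairWord (n + 2) c ∈ C
    have hCS : C ⊆ S.image (pairWord (n + 2)) := by
      intro u hu
      obtain ⟨c, hc, rfl⟩ := exists_pairWord_eq (hC.1 u hu)
      exact Finset.mem_image_of_mem _ (Finset.mem_filter.mpr ⟨hc, hu⟩)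
    refine ((Finset.card_le_card hCS).trans Finset.card_image_le).trans
      (card_le_packingNumber (Finset.filter_subset _ _) fun p q hp hq hpq => ?_)
    simp only [S, decide_eq_true_eq, Finset.mem_filter, closeCells] at hp hq hpq
    by_contra hne
    have h := (disjoint_transpositionBall_iff hp.1 hq.1).mp
      (hC.2 _ hp.2 _ hq.2 fun h => hne (pairWord_injOn _ hp.1 hq.1 h))
    omega
  · classical
    obtain ⟨S, hST, hS, hle⟩ := exists_packing n
    refine hle.trans (hmax ⟨S.image (pairWord (n + 2)), ⟨?_, ?_⟩, ?_⟩)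
    · intro u hu
      obtain ⟨c, hc, rfl⟩ := Finset.mem_image.mp hu
      exact hammingNorm_pairWord (hST hc)
    · intro u hu v hv huv
      obtain ⟨c, hc, rfl⟩ := Finset.mem_image.mp hu
      obtain ⟨d, hd, rfl⟩ := Finset.mem_image.mp hv
      rw [disjoint_transpositionBall_iff (hST hc) (hST hd)]
      by_contra hlt
      refine huv (congrArg _ (hS c d (by simpa using hc) (by simpa using hd) ?_))
      rw [closeCells, decide_eq_true_eq]
      omega
    · exact Finset.card_image_of_injOn ((pairWord_injOn _).mono (by exact_mod_cast hST))

/-! ### The generating function. -/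

theorem packingNumber_add_five {n : ℕ} (hn : 5 ≤ n) :
    packingNumber (n + 5) = packingNumber n + (n + 4) := by
  rw [packingNumber, packingNumber, if_neg (by omega), if_neg (by omega),
    show (n + 5 + 2) * (n + 5 + 1) + 20 = (n + 2) * (n + 1) + 20 + 10 * (n + 4) by ring,
    Nat.add_mul_div_left _ _ (by norm_num)]

open PowerSeries in
theorem mainTheorem2 :
    PowerSeries.mk (fun n : ℕ => (A085680 (n + 2) : ℚ)) =
      (1 - X + X ^ 2 - X ^ 10 + X ^ 11) * ((1 - X) ^ 2 * (1 - X ^ 5))⁻¹ := by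
  rw [PowerSeries.eq_mul_inv_iff_mul_eq (by simp)]
  simp only [A085680_eq]
  set f : PowerSeries ℚ := PowerSeries.mk fun n : ℕ => (packingNumber n : ℚ) with hf
  have h : f * ((1 - X) ^ 2 * (1 - X ^ 5)) = f - (X ^ 1 * f + X ^ 1 * f) + X ^ 2 * f - X ^ 5 * f +
      (X ^ 6 * f + X ^ 6 * f) - X ^ 7 * f := by ring
  rw [h]
  ext n
  simp only [map_add, map_sub, coeff_X_pow_mul', coeff_X_pow, coeff_one, coeff_X, hf, coeff_mk]
  -- From 12 on the numerator has no coefficient and all indices down to `n - 7` are at least 5.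
  -- There `packingNumber_add_five` applies, and the second difference of the linear increment
  -- vanishes.
  rcases lt_or_ge n 12 with hn | hn
  · interval_cases n <;> norm_num [packingNumber]
  · obtain ⟨m, rfl⟩ := Nat.exists_eq_add_of_le' hn
    have h0 := packingNumber_add_five (n := m + 7) (by omega)
    have h1 := packingNumber_add_five (n := m + 6) (by omega)
    have h2 := packingNumber_add_five (n := m + 5) (by omega)
    simp only [add_assoc, Nat.reduceAdd] at h0 h1 h2
    have e : ∀ a b c : ℕ, b + c = a → m + a - b = m + c := by omega
    rw [e 12 1 11 rfl, e 12 2 10 rfl, e 12 5 7 rfl, e 12 6 6 rfl, e 12 7 5 rfl, h0, h1, h2]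
    simp only [show ∀ a, a < 12 → m + 12 ≠ a by omega, if_false, Nat.reduceLT,
      show ∀ a, a < 12 → a ≤ m + 12 by omega, if_true]
    simp
    ring
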